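/- Let $\mathcal G$ be a connected metric graph with finitely many vertices ${\rm v}_1,\dots,{\rm v}_h$ and finitely many (at least one) edges; bounded edges are identified with $[0,\ell_{\rm e}]$, $0<\ell_{\rm e}<\infty$, and unbounded ones with $[0,\infty)$ (so $\mathcal G$ need not be compact; loops and multiple edges are allowed). Let ${\rm dist}$ be the path distance of $\mathcal G$, let $B_r(x_0)=\{x\in\mathcal G:{\rm dist}(x,x_0)<r\}$, and let $H^1(\mathcal G)$ be the space of continuous functions on $\mathcal G$ such that $u_{\rm e},u_{\rm e}'\in L^2({\rm e})$ for every edge ${\rm e}$. Let $p>6$, let $\lambda_n,\rho_n\in\mathbb R$ with $\rho_n\to1$ and $\lambda_n\to+\infty$, and for each $n$ let $u_n\in H^1(\mathcal G)$ be a solution of $$-u_n''+\lambda_nu_n=\rho_nu_n^{p-1}\ \text{ on every edge},\qquad u_n>0\ \text{ on }\mathcal G,\qquad \sum_{{\rm e}\succ{\rm v}}u_{{\rm e},n}'({\rm v})=0\ \text{ at every vertex }{\rm v},$$ where the sum is over the edges incident at ${\rm v}$ (a loop being counted at both of its ends) and the derivatives are taken in the direction pointing from ${\rm v}$ into the edge.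 Let the Morse index $m(u_n)$ be the maximal dimension of a linear subspace $W\subset H^1(\mathcal G)\cap C_c(\mathcal G)$ such that $$\int_{\mathcal G}\Big(|\varphi'|^2+\big(\lambda_n-(p-1)\rho_n|u_n|^{p-2}\big)\varphi^2\Big)\,dx<0\qquad\text{for all }\varphi\in W\setminus\{0\},$$ and suppose that $m(u_n)\le\bar k$ for all $n$, for some integer $\bar k\ge1$. Then, after passing to a subsequence (still indexed by $n$, and along which $\lambda_n>0$), there exist $k\in\{1,\dots,\bar k\}$ and sequences of points $\{P_n^1\},\dots,\{P_n^k\}$ of $\mathcal G$ such that $$\lambda_n^{1/2}\,{\rm dist}(P_n^i,P_n^j)\to+\infty\qquad\forall i\ne j,$$ $$u_n(P_n^i)=\max_{B_{R_n\lambda_n^{-1/2}}(P_n^i)}u_n\qquad\text{for every }i\text{ and }n,\text{ for some positive }R_n\to+\infty,$$ and there are constants $C_1,C_2>0$ such that, for every $R>0$ and every $n$, $$u_n(x)\le C_1\lambda_n^{\frac1{p-2}}\sum_{i=1}^ke^{-C_2\lambda_n^{1/2}{\rm dist}(x,P_n^i)}+C_1\lambda_n^{\frac1{p-2}}\sum_{j=1}^he^{-C_2\lambda_n^{1/2}{\rm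 dist}(x,{\rm v}_j)}\qquad\forall x\in\mathcal G\setminus\bigcup_{i=1}^kB_{R\lambda_n^{-1/2}}(P_n^i).$$ -/

import Mathlib

open Filter Topology MeasureTheory
open scoped ContDiff ENNReal

/-- A metric graph with vertex type `V` and edge type `E` (loops and multiple edges allowed).
The edge `e` is a copy of `[0, len e]` if `len e < ∞`, with `0` glued to the vertex `src e` and
`len e` glued to the vertex `tgt e`; it is a copy of the half-line `[0, ∞)` if `len e = ∞`,
with `0` glued to `src e` (then `tgt e` plays no role anywhere). -/
structure MetricGraph (V E : Type*) where
  len : E → ℝ≥0∞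
  len_pos : ∀ e, 0 < len e
  src : E → V
  tgt : E → V

namespace MetricGraph

variable {V E : Type*}

/-- The closed interval identified with the edge `e`. -/
def I (G : MetricGraph V E) (e : E) : Set ℝ :=
  {t | 0 ≤ t ∧ ENNReal.ofReal t ≤ G.len e}

/-- The points of the graph: the vertices, and the interior points of the edges. -/
inductive Point (G : MetricGraph V E) where
  | vertex (v : V) : Point G
  | inner (e : E) (t : ℝ) (h0 : 0 < t) (h1 : ENNReal.ofReal t < G.len e) : Point G

open Classical in
/-- The point of coordinate `t` on the edge `e`, for `t ∈ G.I e`; the endpoints of `e` are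
vertices. (Real numbers outside `G.I e` are first moved to the nearest point of `G.I e`.) -/
noncomputable def pt (G : MetricGraph V E) (e : E) (t : ℝ) : G.Point :=
  if h0 : t ≤ 0 then .vertex (G.src e)
  else if h1 : G.len e ≤ ENNReal.ofReal t then .vertex (G.tgt e)
  else .inner e t (not_le.mp h0) (not_le.mp h1)

/-- The restriction `u_e` of a function `u` on the graph to the edge `e`. -/
noncomputable def res (G : MetricGraph V E) (u : G.Point → ℝ) (e : E) : ℝ → ℝ :=
  fun t => u (G.pt e t)

/-- The quotient topology of the disjoint union of the edges. -/
noncomputable instance (G : MetricGraph V E) : TopologicalSpace G.Point :=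
  ⨆ e : E, TopologicalSpace.coinduced (G.pt e) inferInstance

/-- `G.IsPath x y L`: there is a path from `x` to `y` made of finitely many segments, each of them
contained in one edge, of total length `L`. -/
inductive IsPath (G : MetricGraph V E) : G.Point → G.Point → ℝ → Prop where
  | refl (x : G.Point) : IsPath G x x 0
  | step {x y z : G.Point} {e : E} {s t L : ℝ} (hs : s ∈ G.I e) (ht : t ∈ G.I e)
      (hx : G.pt e s = x) (hy : G.pt e t = y) (h : IsPath G y z L) : IsPath G x z (|s - t| + L)

/-- The graph is connected: any two points are joined by a path. -/
def IsConnected (G : MetricGraph V E) : Prop :=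
  ∀ x y : G.Point, ∃ L, G.IsPath x y L

/-- The distance of a connected metric graph: the infimum of the lengths of the paths. -/
noncomputable def dist (G : MetricGraph V E) (x y : G.Point) : ℝ :=
  sInf {L | G.IsPath x y L}

/-- The open ball with centre `x` and radius `r`. -/
def ball (G : MetricGraph V E) (x : G.Point) (r : ℝ) : Set G.Point :=
  {y | G.dist y x < r}

/-- The family `g = (g_e)` is the weak derivative of `u = (u_e)` along the edges, and lies in `L²`
on every edge. -/
def IsWeakDeriv (G : MetricGraph V E) (u : G.Point → ℝ) (g : E → ℝ → ℝ) : Prop :=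
  ∀ e, MemLp (g e) 2 (volume.restrict (G.I e)) ∧
    ∀ ψ : ℝ → ℝ, ContDiff ℝ ∞ ψ → HasCompactSupport ψ → tsupport ψ ⊆ interior (G.I e) →
      ∫ t in G.I e, G.res u e t * deriv ψ t = - ∫ t in G.I e, g e t * ψ t

/-- The Sobolev space `H¹` of the graph: continuous functions on the graph which belong to
`H¹` of every edge. -/
def MemH1 (G : MetricGraph V E) (u : G.Point → ℝ) : Prop :=
  Continuous u ∧ (∀ e, MemLp (G.res u e) 2 (volume.restrict (G.I e))) ∧
    ∃ g, G.IsWeakDeriv u g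

open Classical in
/-- The weak derivative of `u` in `L²` (unique up to null sets), if there is one. -/
noncomputable def weakDeriv (G : MetricGraph V E) (u : G.Point → ℝ) : E → ℝ → ℝ :=
  if h : ∃ g, G.IsWeakDeriv u g then h.choose else 0

/-- The quadratic form
`Q(φ; U) = ∫_G |φ'|² + (lam - (p - 1) rho |U|^(p-2)) φ²`. -/
noncomputable def Q [Fintype E] (G : MetricGraph V E) (p lam rho : ℝ) (U φ : G.Point → ℝ) : ℝ :=
  ∑ e, ∫ t in G.I e, ((G.weakDeriv φ e t) ^ 2 +
    (lam - (p - 1) * rho * |G.res U e t| ^ (p - 2)) * (G.res φ e t) ^ 2)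

/-- The Morse index of `U`: the maximal dimension of a space of compactly supported `H¹` functions
on which `Q(· ; U)` is negative definite. -/
noncomputable def morseIndex [Fintype E] (G : MetricGraph V E) (p lam rho : ℝ)
    (U : G.Point → ℝ) : ℕ∞ :=
  ⨆ (W : Submodule ℝ (G.Point → ℝ))
    (_ : ∀ φ ∈ W, G.MemH1 φ ∧ HasCompactSupport φ ∧ (φ ≠ 0 → G.Q p lam rho U φ < 0)),
    Cardinal.toENat (Module.rank ℝ W)

open Classical in
/-- The sum, over the edges incident at `v`, of the derivatives of `u` at `v` in the direction
pointing from `v` into the edge (a loop at `v` contributes at both of its ends). -/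
noncomputable def kirchhoffSum [Fintype E] (G : MetricGraph V E) (u : G.Point → ℝ) (v : V) : ℝ :=
  ∑ e, ((if G.src e = v then derivWithin (G.res u e) (G.I e) 0 else 0) -
    (if G.tgt e = v ∧ G.len e ≠ ⊤ then derivWithin (G.res u e) (G.I e) (G.len e).toReal else 0))

/-- `u ∈ H¹` is a positive solution of `-u'' + lam u = rho u^(p-1)` on the graph, with Kirchhoff
conditions at the vertices. -/
structure IsPositiveSolution [Fintype E] (G : MetricGraph V E) (p lam rho : ℝ)
    (u : G.Point → ℝ) : Prop where
  memH1 : G.MemH1 u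
  pos : ∀ x, 0 < u x
  contDiffOn : ∀ e, ContDiffOn ℝ 2 (G.res u e) (G.I e)
  eqn : ∀ e, ∀ t ∈ G.I e,
    - iteratedDerivWithin 2 (G.res u e) (G.I e) t + lam * G.res u e t
      = rho * (G.res u e t) ^ (p - 1)
  kirchhoff : ∀ v, G.kirchhoffSum u v = 0

end MetricGraph

/-! Everything is measured at the length scale `lam ^ (-1/2)` and the height scale `A = lam ^ (1 /
(p - 2))`; direct estimates take the place of a blow-up analysis.

Upper bound. On an edge `u'^2 / 2 + rho * u^p / p - lam * u^2 / 2` is constant. If this energy were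
large compared with `lam * A^2`, then `u' / u` would satisfy a Riccati inequality that cannot last
over a length `lam ^ (-1/2)`. Hence `u ≲ A` and `|u'| ≲ lam ^ (1/2) * A` (`energy_le`,
`solution_le`).

Counting. Testing the equation with `u * η^2`, where the Kirchhoff conditions remove the boundary
terms, gives `Q (u η) = ∫ u^2 η'^2 - (p - 2) rho ∫ u^p η^2`. If `u x ≥ μ * A` and `η` is a cutoff at
radius `R * lam ^ (-1/2)` around `x`, the first term is `O(1 / R)` relative to the second, so a
fixed large `R` makes `Q` negative (`Q_mul_cutoff_neg_of_le`). Such functions with disjoint supports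
span a negative space, so the Morse index bounds the number of well separated points of `{u ≥ μ *
A}`, and this set is covered by `kbar` balls of radius `O(lam ^ (-1/2))` (`exists_concentration`).

Decay. Where `u < μ * A` one has `u'' ≥ (lam / 4) * u`, and comparison with `cosh` yields
exponential decay away from that set and from the vertices (`mul_cosh_le`, `le_sum_exp_of_cover`).

Clusters. Along a subsequence each rescaled distance between two centres is bounded or tends to
infinity. Centres at bounded distance are grouped, and `P i` is a maximum point of `u` on the union
of the balls of a group (`exists_clusters`). -/

namespace MetricGraph

variable {V E : Type*}

/-! ### Edges, path distance and balls. -/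

section Metric

variable {G : MetricGraph V E}

theorem I_of_ne_top {e : E} (h : G.len e ≠ ⊤) : G.I e = Set.Icc 0 (G.len e).toReal := by
  ext t
  simp only [I, Set.mem_ofPred_eq, Set.mem_Icc]
  rw [ENNReal.ofReal_le_iff_le_toReal h]

theorem I_of_eq_top {e : E} (h : G.len e = ⊤) : G.I e = Set.Ici 0 := by
  ext t
  simp [I, h]

theorem toReal_len_pos {e : E} (h : G.len e ≠ ⊤) : 0 < (G.len e).toReal :=
  ENNReal.toReal_pos (G.len_pos e).ne' h

theorem zero_mem_I (e : E) : (0 : ℝ) ∈ G.I e := by simp [I]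

theorem toReal_len_mem_I {e : E} (h : G.len e ≠ ⊤) : (G.len e).toReal ∈ G.I e := by
  rw [I_of_ne_top h]; exact ⟨ENNReal.toReal_nonneg, le_rfl⟩

theorem isClosed_I (e : E) : IsClosed (G.I e) := by
  by_cases h : G.len e = ⊤
  · rw [I_of_eq_top h]; exact isClosed_Ici
  · rw [I_of_ne_top h]; exact isClosed_Icc

theorem ordConnected_I (e : E) : (G.I e).OrdConnected := by
  by_cases h : G.len e = ⊤
  · rw [I_of_eq_top h]; infer_instance
  · rw [I_of_ne_top h]; infer_instance

theorem Icc_subset_I {e : E} {a b : ℝ} (ha : a ∈ G.I e) (hb : b ∈ G.I e) :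
    Set.Icc a b ⊆ G.I e := (ordConnected_I e).out ha hb

theorem uniqueDiffOn_I (e : E) : UniqueDiffOn ℝ (G.I e) := by
  by_cases h : G.len e = ⊤
  · rw [I_of_eq_top h]; exact uniqueDiffOn_Ici 0
  · rw [I_of_ne_top h]; exact uniqueDiffOn_Icc (toReal_len_pos h)

theorem pt_of_nonpos {e : E} {t : ℝ} (h : t ≤ 0) : G.pt e t = .vertex (G.src e) := by
  simp [pt, h]

theorem pt_zero (e : E) : G.pt e 0 = .vertex (G.src e) := pt_of_nonpos le_rfl

theorem pt_toReal_len {e : E} (h : G.len e ≠ ⊤) :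
    G.pt e (G.len e).toReal = .vertex (G.tgt e) := by
  have := toReal_len_pos h
  simp [pt, h, this.not_ge]

open Classical in
/-- The nearest point of `G.I e`. -/
noncomputable def clamp (G : MetricGraph V E) (e : E) (t : ℝ) : ℝ :=
  if G.len e = ⊤ then max 0 t else max 0 (min t (G.len e).toReal)

theorem clamp_mem (e : E) (t : ℝ) : G.clamp e t ∈ G.I e := by
  by_cases h : G.len e = ⊤
  · simp [clamp, h, I_of_eq_top h]
  · simp only [clamp, h, if_false, I_of_ne_top h]
    exact ⟨le_max_left _ _, max_le ENNReal.toReal_nonneg (min_le_right _ _)⟩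

theorem clamp_of_mem {e : E} {t : ℝ} (ht : t ∈ G.I e) : G.clamp e t = t := by
  by_cases h : G.len e = ⊤
  · rw [I_of_eq_top h] at ht
    simpa [clamp, h] using ht
  · rw [I_of_ne_top h] at ht
    simp [clamp, h, ht.1, ht.2]

theorem pt_clamp (e : E) (t : ℝ) : G.pt e (G.clamp e t) = G.pt e t := by
  rcases le_or_gt t 0 with h0 | h0
  · have : G.clamp e t = 0 := by
      by_cases h : G.len e = ⊤
      · simp [clamp, h, h0]
      · simp only [clamp, h, if_false]
        exact max_eq_left ((min_le_left _ _).trans h0)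
    rw [this, pt_zero, pt_of_nonpos h0]
  by_cases hm : t ∈ G.I e
  · rw [clamp_of_mem hm]
  · by_cases h : G.len e = ⊤
    · rw [I_of_eq_top h] at hm
      exact absurd h0.le hm
    · rw [I_of_ne_top h, Set.mem_Icc, not_and, not_le] at hm
      have h1 := hm h0.le
      have : G.clamp e t = (G.len e).toReal := by
        simp [clamp, h, h1.le]
      rw [this, pt_toReal_len h]
      have : G.len e ≤ ENNReal.ofReal t :=
        (ENNReal.le_ofReal_iff_toReal_le h h0.le).2 h1.le
      simp [pt, h0.not_ge, this]

theorem abs_clamp_sub_clamp_le (e : E) (s t : ℝ) : |G.clamp e s - G.clamp e t| ≤ |s - t| := by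
  by_cases h : G.len e = ⊤
  · simp only [clamp, h, if_true]
    simpa [max_comm] using abs_max_sub_max_le_abs s t 0
  · simp only [clamp, h, if_false]
    refine le_trans (b := |min s (G.len e).toReal - min t (G.len e).toReal|) ?_ ?_
    · simpa [max_comm] using
        abs_max_sub_max_le_abs (min s (G.len e).toReal) (min t (G.len e).toReal) 0
    · have := abs_min_sub_min_le_max s (G.len e).toReal t (G.len e).toReal
      simpa using this

theorem pt_eq_inner {e : E} {t : ℝ} (h0 : 0 < t) (h1 : ENNReal.ofReal t < G.len e) :
    G.pt e t = .inner e t h0 h1 := by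
  simp [pt, h0.not_ge, h1.not_ge]

theorem pt_cases {e : E} {t : ℝ} (ht : t ∈ G.I e) :
    (t = 0 ∧ G.pt e t = .vertex (G.src e)) ∨
    (G.len e ≠ ⊤ ∧ t = (G.len e).toReal ∧ G.pt e t = .vertex (G.tgt e)) ∨
    ∃ h0 h1, G.pt e t = .inner e t h0 h1 := by
  rcases ht.1.eq_or_lt with h0 | h0
  · left; subst h0; exact ⟨rfl, pt_zero e⟩
  rcases ht.2.eq_or_lt with h1 | h1
  · right; left
    have h : G.len e ≠ ⊤ := by rw [← h1]; exact ENNReal.ofReal_ne_top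
    have : t = (G.len e).toReal := by rw [← h1, ENNReal.toReal_ofReal h0.le]
    exact ⟨h, this, by rw [this, pt_toReal_len h]⟩
  · right; right
    exact ⟨h0, h1, pt_eq_inner h0 h1⟩

theorem IsPath.nonneg {x y : G.Point} {L : ℝ} (h : G.IsPath x y L) : 0 ≤ L := by
  induction h with
  | refl => exact le_rfl
  | step _ _ _ _ _ ih => positivity

theorem IsPath.trans {x y z : G.Point} {L M : ℝ} (h : G.IsPath x y L) (h' : G.IsPath y z M) :
    G.IsPath x z (L + M) := by
  induction h with
  | refl => simpa using h'
  | step hs ht hx hy _ ih => rw [add_assoc]; exact .step hs ht hx hy (ih h')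

theorem IsPath.single {e : E} {s t : ℝ} (hs : s ∈ G.I e) (ht : t ∈ G.I e) :
    G.IsPath (G.pt e s) (G.pt e t) |s - t| := by
  simpa using IsPath.step hs ht rfl rfl (.refl (G.pt e t))

theorem IsPath.symm {x y : G.Point} {L : ℝ} (h : G.IsPath x y L) : G.IsPath y x L := by
  induction h with
  | refl => exact .refl _
  | step hs ht hx hy _ ih =>
    subst hx hy
    rw [add_comm, abs_sub_comm]
    exact ih.trans (.single ht hs)

theorem bddBelow_path (x y : G.Point) : BddBelow {L | G.IsPath x y L} :=
  ⟨0, fun _ h => h.nonneg⟩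

theorem dist_nonneg (x y : G.Point) : 0 ≤ G.dist x y :=
  Real.sInf_nonneg fun _ h => h.nonneg

theorem dist_le_of_isPath {x y : G.Point} {L : ℝ} (h : G.IsPath x y L) : G.dist x y ≤ L :=
  csInf_le (bddBelow_path x y) h

theorem dist_self (x : G.Point) : G.dist x x = 0 :=
  le_antisymm (dist_le_of_isPath (.refl x)) (dist_nonneg x x)

theorem dist_comm (x y : G.Point) : G.dist x y = G.dist y x := by
  unfold dist
  congr 1
  ext L
  exact ⟨IsPath.symm, IsPath.symm⟩

theorem dist_pt_pt_le (e : E) (s t : ℝ) : G.dist (G.pt e s) (G.pt e t) ≤ |s - t| := by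
  rw [← pt_clamp e s, ← pt_clamp e t]
  exact (dist_le_of_isPath (.single (clamp_mem e s) (clamp_mem e t))).trans
    (abs_clamp_sub_clamp_le e s t)

theorem dist_triangle (hG : G.IsConnected) (x y z : G.Point) :
    G.dist x z ≤ G.dist x y + G.dist y z := by
  have h1 : G.dist x z - G.dist y z ≤ G.dist x y := by
    refine le_csInf (hG x y) fun L hL => ?_
    rw [sub_le_comm]
    refine le_csInf (hG y z) fun M hM => ?_
    rw [sub_le_iff_le_add']
    exact dist_le_of_isPath (IsPath.trans hL hM)
  linarith

/-- This is how lower bounds for an infimum over paths are obtained: the increments of `f` add up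
along each path. -/
theorem abs_sub_le_dist (hG : G.IsConnected) {f : G.Point → ℝ}
    (hf : ∀ e, ∀ s ∈ G.I e, ∀ t ∈ G.I e, |G.res f e s - G.res f e t| ≤ |s - t|)
    (x y : G.Point) : |f x - f y| ≤ G.dist x y := by
  refine le_csInf (hG x y) fun L hL => ?_
  induction hL with
  | refl => simp
  | @step x y z e s t L hs ht hx hy _ ih =>
    have := hf e s hs t ht
    simp only [res, hx, hy] at this
    exact (abs_sub_le _ (f y) _).trans (add_le_add this ih)

/-- Connectedness excludes a vertex lying on no edge: a path from it to an interior point of some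
edge has a first segment, and that segment starts at the vertex. -/
theorem exists_pt_eq [Nonempty E] (hG : G.IsConnected) (x : G.Point) :
    ∃ e, ∃ t ∈ G.I e, G.pt e t = x := by
  obtain ⟨e₀⟩ := ‹Nonempty E›
  cases x with
  | inner e t h0 h1 => exact ⟨e, t, ⟨h0.le, h1.le⟩, pt_eq_inner h0 h1⟩
  | vertex v =>
    obtain ⟨c, hc0, hc1⟩ := ENNReal.lt_iff_exists_nnreal_btwn.1 (G.len_pos e₀)
    have hc0' : (0 : ℝ) < c := by exact_mod_cast hc0
    obtain ⟨L, hL⟩ := hG (.vertex v) (.inner e₀ c hc0' (by simpa using hc1))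
    cases hL with
    | step hs _ hx _ _ => exact ⟨_, _, hs, hx⟩

theorem continuous_pt (e : E) : Continuous (G.pt e) :=
  continuous_iff_coinduced_le.2 (le_iSup (fun e => TopologicalSpace.coinduced (G.pt e) _) e)

theorem continuous_iff_res {f : G.Point → ℝ} : Continuous f ↔ ∀ e, Continuous (G.res f e) := by
  rw [continuous_iSup_dom]
  exact forall_congr' fun e => continuous_coinduced_dom

theorem res_clamp (f : G.Point → ℝ) (e : E) (t : ℝ) : G.res f e (G.clamp e t) = G.res f e t := by
  simp [res, pt_clamp]

theorem lipschitzWith_dist (hG : G.IsConnected) (x : G.Point) (e : E) :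
    LipschitzWith 1 (G.res (fun y => G.dist y x) e) := by
  refine LipschitzWith.of_dist_le_mul fun s t => ?_
  have h1 := dist_triangle hG (G.pt e s) (G.pt e t) x
  have h2 := dist_triangle hG (G.pt e t) (G.pt e s) x
  have h3 := dist_pt_pt_le (G := G) e s t
  rw [dist_comm (G.pt e t) (G.pt e s)] at h2
  rw [Real.dist_eq, Real.dist_eq, NNReal.coe_one, one_mul, abs_le]
  constructor <;> simp only [res] <;> linarith

theorem continuous_dist (hG : G.IsConnected) (x : G.Point) :
    Continuous (fun y => G.dist y x) :=
  continuous_iff_res.2 fun e => (lipschitzWith_dist hG x e).continuous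

open Classical in
/-- The distance of the coordinate `t` from the ends of the edge `e`. -/
noncomputable def tent (G : MetricGraph V E) (e : E) (t : ℝ) : ℝ :=
  if G.len e = ⊤ then t else min t ((G.len e).toReal - t)

open Classical in
/-- The tent function on the edge `e`, extended by zero. -/
noncomputable def tentFun (G : MetricGraph V E) (e : E) : G.Point → ℝ
  | .vertex _ => 0
  | .inner e' t _ _ => if e' = e then G.tent e t else 0

theorem res_tentFun_self {e : E} {t : ℝ} (ht : t ∈ G.I e) :
    G.res (G.tentFun e) e t = G.tent e t := by
  rcases pt_cases ht with ⟨h, h'⟩ | ⟨hl, h, h'⟩ | ⟨h0, h1, h'⟩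
  · subst h
    simp only [res, h', tentFun, tent]
    split_ifs <;> simp
  · simp only [res, h', tentFun, tent, hl]
    simp [h]
  · simp [res, h', tentFun]

theorem res_tentFun_of_ne {e e' : E} (hne : e' ≠ e) {t : ℝ} (ht : t ∈ G.I e') :
    G.res (G.tentFun e) e' t = 0 := by
  rcases pt_cases ht with ⟨h, h'⟩ | ⟨hl, h, h'⟩ | ⟨h0, h1, h'⟩ <;>
    simp [res, h', tentFun, hne]

theorem abs_tent_sub_le (e : E) (s t : ℝ) : |G.tent e s - G.tent e t| ≤ |s - t| := by
  by_cases h : G.len e = ⊤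
  · simp [tent, h]
  · simp only [tent, h, if_false]
    refine (abs_min_sub_min_le_max _ _ _ _).trans (max_le le_rfl ?_)
    rw [sub_sub_sub_cancel_left, abs_sub_comm]

/-- The coordinate itself need not be 1-Lipschitz for the distance, since a short path outside `e`
may join its two ends. The distance to the ends is, because it extends by zero to the rest of the
graph. -/
theorem abs_tent_sub_le_dist (hG : G.IsConnected) {e : E} {s t : ℝ} (hs : s ∈ G.I e)
    (ht : t ∈ G.I e) : |G.tent e s - G.tent e t| ≤ G.dist (G.pt e s) (G.pt e t) := by
  have := abs_sub_le_dist hG (f := G.tentFun e) (fun e' a ha b hb => ?_) (G.pt e s) (G.pt e t)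
  · change |G.res (G.tentFun e) e s - G.res (G.tentFun e) e t| ≤ _ at this
    rwa [res_tentFun_self hs, res_tentFun_self ht] at this
  · by_cases h : e' = e
    · subst h
      rw [res_tentFun_self ha, res_tentFun_self hb]
      exact abs_tent_sub_le e' a b
    · rw [res_tentFun_of_ne h ha, res_tentFun_of_ne h hb]
      simp

/-- The trace on the edge `e` of a closed ball. -/
def ballTrace (G : MetricGraph V E) (x : G.Point) (r : ℝ) (e : E) : Set ℝ :=
  {t | t ∈ G.I e ∧ G.dist (G.pt e t) x ≤ r}

theorem isClosed_ballTrace (hG : G.IsConnected) (x : G.Point) (r : ℝ) (e : E) :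
    IsClosed (G.ballTrace x r e) :=
  (isClosed_I e).inter
    (isClosed_le (lipschitzWith_dist hG x e).continuous continuous_const)

/-- Points of the ball on one edge have `tent` values within `2 * r` of each other, and `tent` is
either `t` or `len - t`: hence two intervals. This gives compactness of balls also on half-lines,
and a length bound linear in `r`. -/
theorem ballTrace_subset (hG : G.IsConnected) {x : G.Point} {r : ℝ} {e : E} :
    ∃ a, G.ballTrace x r e ⊆
      Set.Icc a (a + 4 * r) ∪ Set.Icc ((G.len e).toReal - a - 4 * r) ((G.len e).toReal - a) := by
  rcases (G.ballTrace x r e).eq_empty_or_nonempty with h | ⟨s, hs, hsx⟩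
  · exact ⟨0, by simp [h]⟩
  refine ⟨G.tent e s - 2 * r, fun t ⟨ht, htx⟩ => ?_⟩
  have h1 := abs_tent_sub_le_dist hG hs ht
  have h2 := dist_triangle hG (G.pt e s) x (G.pt e t)
  rw [dist_comm x] at h2
  obtain ⟨h3, h4⟩ := abs_le.1 (h1.trans (h2.trans (add_le_add hsx htx)))
  have h5 : G.tent e t = t ∨ G.tent e t = (G.len e).toReal - t := by
    unfold tent
    split_ifs
    · exact .inl rfl
    · exact min_choice _ _
  rcases h5 with h5 | h5
  · left
    rw [h5] at h3 h4
    constructor <;> linarith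
  · right
    rw [h5] at h3 h4
    constructor <;> linarith

theorem isCompact_ballTrace (hG : G.IsConnected) (x : G.Point) (r : ℝ) (e : E) :
    IsCompact (G.ballTrace x r e) := by
  obtain ⟨a, ha⟩ := ballTrace_subset hG (x := x) (r := r) (e := e)
  exact (isCompact_Icc.union isCompact_Icc).of_isClosed_subset (isClosed_ballTrace hG x r e) ha

theorem volume_ballTrace_le (hG : G.IsConnected) (x : G.Point) {r : ℝ} (hr : 0 ≤ r) (e : E) :
    volume.real (G.ballTrace x r e) ≤ 8 * r := by
  obtain ⟨a, ha⟩ := ballTrace_subset hG (x := x) (r := r) (e := e)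
  refine (measureReal_mono ha ?_).trans ((measureReal_union_le _ _).trans ?_)
  · exact (isCompact_Icc.union isCompact_Icc).measure_lt_top.ne
  · rw [Real.volume_real_Icc_of_le (by linarith), Real.volume_real_Icc_of_le (by linarith)]
    linarith

theorem isCompact_closedBall [Finite E] [Nonempty E] (hG : G.IsConnected) (x : G.Point) (r : ℝ) :
    IsCompact {y | G.dist y x ≤ r} := by
  have : {y | G.dist y x ≤ r} = ⋃ e, G.pt e '' G.ballTrace x r e := by
    ext y
    simp only [Set.mem_ofPred_eq, Set.mem_iUnion, Set.mem_image, ballTrace]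
    constructor
    · intro hy
      obtain ⟨e, t, ht, rfl⟩ := exists_pt_eq hG y
      exact ⟨e, t, ⟨ht, hy⟩, rfl⟩
    · rintro ⟨e, t, ⟨_, h⟩, rfl⟩
      exact h
  rw [this]
  exact isCompact_iUnion fun e => (isCompact_ballTrace hG x r e).image (continuous_pt e)

theorem isClosed_closedBall (hG : G.IsConnected) (x : G.Point) (r : ℝ) :
    IsClosed {y | G.dist y x ≤ r} :=
  isClosed_le (continuous_dist hG x) continuous_const

end Metric

/-! ### Lipschitz test functions and their weak derivatives. -/

section TestFunctions

variable {G : MetricGraph V E}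

/-- Functions which are Lipschitz on every edge and vanish outside a ball. -/
structure IsTest (G : MetricGraph V E) (φ : G.Point → ℝ) : Prop where
  lipschitz : ∀ e, ∃ K, LipschitzWith K (G.res φ e)
  support : ∃ x r, ∀ y, φ y ≠ 0 → G.dist y x ≤ r

theorem mem_interior_I_of_top {e : E} (h : G.len e = ⊤) {t : ℝ} (ht : 0 < t) :
    t ∈ interior (G.I e) := by
  rw [I_of_eq_top h, interior_Ici]; exact ht

theorem ae_mem_interior_I (e : E) : ∀ᵐ t ∂volume.restrict (G.I e), t ∈ interior (G.I e) := by
  have hne : ∀ c : ℝ, ∀ᵐ t ∂volume.restrict (G.I e), t ≠ c := fun c =>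
    ae_restrict_of_ae (by simp [ae_iff])
  filter_upwards [ae_restrict_mem (isClosed_I e).measurableSet, hne 0, hne (G.len e).toReal]
    with t ht h0 h1
  by_cases h : G.len e = ⊤
  · exact mem_interior_I_of_top h (lt_of_le_of_ne ht.1 (Ne.symm h0))
  · rw [I_of_ne_top h] at ht ⊢
    rw [interior_Icc]
    exact ⟨lt_of_le_of_ne ht.1 (Ne.symm h0), lt_of_le_of_ne ht.2 h1⟩

theorem zero_notMem_interior_I (e : E) : (0 : ℝ) ∉ interior (G.I e) := fun h => by
  have : interior (G.I e) ⊆ interior (Set.Ici 0) := interior_mono fun t ht => ht.1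
  have := this h
  simp at this

theorem toReal_len_notMem_interior_I {e : E} (h : G.len e ≠ ⊤) :
    (G.len e).toReal ∉ interior (G.I e) := by
  simp [I_of_ne_top h, interior_Icc]

/-- A bound for the support of a function on the edge `e`, equal to the length of `e` if this is
finite. -/
theorem exists_end {f : ℝ → ℝ} {e : E} {S : Set ℝ} (hS : IsCompact S)
    (hf : ∀ t ∈ G.I e, t ∉ S → f t = 0) :
    ∃ b ∈ G.I e, (G.len e ≠ ⊤ → b = (G.len e).toReal) ∧
      (G.len e = ⊤ → f b = 0) ∧ ∀ t ∈ G.I e, b < t → f t = 0 ∧ deriv f t = 0 := by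
  by_cases h : G.len e = ⊤
  · obtain ⟨M, hM⟩ := hS.bddAbove
    have hz : ∀ t, 0 < t → M < t → f t = 0 := fun t ht hMt =>
      hf t (by rw [I_of_eq_top h]; exact ht.le) fun hmem => absurd (hM hmem) (not_le.2 hMt)
    refine ⟨max M 0 + 1, ?_, fun h' => absurd h h', fun _ => ?_, ?_⟩
    · rw [I_of_eq_top h, Set.mem_Ici]; positivity
    · exact hz _ (by positivity) (by linarith [le_max_left M 0])
    · intro t _ ht
      have h1 : M < t := by linarith [le_max_left M 0]
      have h2 : 0 < t := by linarith [le_max_right M 0]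
      refine ⟨hz t h2 h1, ?_⟩
      have : f =ᶠ[𝓝 t] fun _ => 0 := by
        filter_upwards [lt_mem_nhds h1, lt_mem_nhds h2] with s hs1 hs2
        exact hz s hs2 hs1
      rw [this.deriv_eq, deriv_const]
  · have hnot : ∀ t ∈ G.I e, ¬ (G.len e).toReal < t := fun t ht hlt => by
      rw [I_of_ne_top h] at ht; exact absurd ht.2 (not_le.2 hlt)
    exact ⟨(G.len e).toReal, toReal_len_mem_I h, fun _ => rfl, fun h' => absurd h' h,
      fun t ht hlt => absurd hlt (hnot t ht)⟩

theorem setIntegral_I_eq {h : ℝ → ℝ} {e : E} {b : ℝ} (hb : b ∈ G.I e)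
    (hh : ∀ t ∈ G.I e, b < t → h t = 0) : ∫ t in G.I e, h t = ∫ t in (0)..b, h t := by
  have hsub : Set.Icc 0 b ⊆ G.I e := Icc_subset_I (zero_mem_I e) hb
  rw [intervalIntegral.integral_of_le hb.1, ← integral_Icc_eq_integral_Ioc]
  refine setIntegral_eq_of_subset_of_forall_sdiff_eq_zero (isClosed_I e).measurableSet hsub ?_
  rintro t ⟨ht, ht'⟩
  exact hh t ht (not_le.1 fun hle => ht' ⟨ht.1, hle⟩)

theorem abs_deriv_le_of_lipschitzWith {f : ℝ → ℝ} {K : NNReal} (hf : LipschitzWith K f) (t : ℝ) :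
    |deriv f t| ≤ K :=
  norm_deriv_le_of_lipschitz hf

theorem memLp_of_bounded_of_support {f : ℝ → ℝ} {e : E} {S : Set ℝ} (hS : IsCompact S) {C : ℝ}
    (hfm : AEStronglyMeasurable f (volume.restrict (G.I e))) (hC : ∀ t ∈ G.I e, |f t| ≤ C)
    (hf : ∀ᵐ t ∂volume.restrict (G.I e), t ∉ S → f t = 0) :
    MemLp f 2 (volume.restrict (G.I e)) := by
  have h1 : MemLp (S.indicator fun _ => C) 2 (volume.restrict (G.I e)) := by
    refine (memLp_indicator_iff_restrict hS.measurableSet).2 ?_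
    have : IsFiniteMeasure ((volume.restrict (G.I e)).restrict S) := by
      refine ⟨?_⟩
      rw [Measure.restrict_apply_univ]
      exact (Measure.restrict_apply_le _ _).trans_lt hS.measure_lt_top
    exact memLp_const C
  refine h1.mono hfm ?_
  filter_upwards [hf, ae_restrict_mem (isClosed_I e).measurableSet] with t ht hI
  by_cases h : t ∈ S
  · simp only [h, Set.indicator_of_mem, Real.norm_eq_abs]
    exact (hC t hI).trans (le_abs_self C)
  · simp [ht h]

theorem IsTest.continuous {φ : G.Point → ℝ} (hφ : G.IsTest φ) : Continuous φ :=
  continuous_iff_res.2 fun e => (hφ.lipschitz e).choose_spec.continuous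

theorem IsTest.exists_compact (hG : G.IsConnected) {φ : G.Point → ℝ} (hφ : G.IsTest φ) (e : E) :
    ∃ S, IsCompact S ∧ ∀ t ∈ G.I e, t ∉ S → G.res φ e t = 0 := by
  obtain ⟨x, r, h⟩ := hφ.support
  refine ⟨G.ballTrace x r e, isCompact_ballTrace hG x r e, fun t ht hn => ?_⟩
  by_contra hne
  exact hn ⟨ht, h _ hne⟩

theorem ae_deriv_eq_zero {f : ℝ → ℝ} {e : E} {S : Set ℝ} (hS : IsCompact S)
    (hf : ∀ t ∈ G.I e, t ∉ S → f t = 0) :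
    ∀ᵐ t ∂volume.restrict (G.I e), t ∉ S → deriv f t = 0 := by
  filter_upwards [ae_mem_interior_I e] with t ht hn
  have : f =ᶠ[𝓝 t] fun _ => 0 := by
    filter_upwards [isOpen_interior.mem_nhds ht, hS.isClosed.isOpen_compl.mem_nhds hn]
      with s hs1 hs2
    exact hf s (interior_subset hs1) hs2
  rw [this.deriv_eq, deriv_const]

theorem IsTest.exists_bound (hG : G.IsConnected) {φ : G.Point → ℝ} (hφ : G.IsTest φ) (e : E) :
    ∃ C, ∀ t ∈ G.I e, |G.res φ e t| ≤ C := by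
  obtain ⟨S, hS, h⟩ := hφ.exists_compact hG e
  obtain ⟨K, hK⟩ := hφ.lipschitz e
  obtain ⟨C, hC⟩ := hS.exists_bound_of_continuousOn hK.continuous.continuousOn
  refine ⟨max C 0, fun t ht => ?_⟩
  by_cases hm : t ∈ S
  · exact (hC t hm).trans (le_max_left _ _)
  · rw [h t ht hm]; simp

theorem IsTest.memLp_res (hG : G.IsConnected) {φ : G.Point → ℝ} (hφ : G.IsTest φ) (e : E) :
    MemLp (G.res φ e) 2 (volume.restrict (G.I e)) := by
  obtain ⟨S, hS, h⟩ := hφ.exists_compact hG e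
  obtain ⟨K, hK⟩ := hφ.lipschitz e
  obtain ⟨C, hC⟩ := hφ.exists_bound hG e
  refine memLp_of_bounded_of_support hS hK.continuous.aestronglyMeasurable hC ?_
  filter_upwards [ae_restrict_mem (isClosed_I e).measurableSet] with t ht hn using h t ht hn

theorem IsTest.memLp_deriv (hG : G.IsConnected) {φ : G.Point → ℝ} (hφ : G.IsTest φ) (e : E) :
    MemLp (deriv (G.res φ e)) 2 (volume.restrict (G.I e)) := by
  obtain ⟨S, hS, h⟩ := hφ.exists_compact hG e
  obtain ⟨K, hK⟩ := hφ.lipschitz e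
  exact memLp_of_bounded_of_support hS (measurable_deriv _).aestronglyMeasurable
    (fun t _ => abs_deriv_le_of_lipschitzWith hK t) (ae_deriv_eq_zero hS h)

/-- Integration by parts on `[0, b]` for absolutely continuous functions. The boundary term at `0`
vanishes through `ψ`; the one at `b` vanishes through `ψ` on a bounded edge and through `φ` on a
half-line. -/
theorem IsTest.isWeakDeriv (hG : G.IsConnected) {φ : G.Point → ℝ} (hφ : G.IsTest φ) :
    G.IsWeakDeriv φ fun e => deriv (G.res φ e) := by
  refine fun e => ⟨hφ.memLp_deriv hG e, fun ψ hψ hψc hψI => ?_⟩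
  obtain ⟨S, hS, h⟩ := hφ.exists_compact hG e
  obtain ⟨K, hK⟩ := hφ.lipschitz e
  obtain ⟨b, hb, hbl, hbt, hbz⟩ := exists_end hS h
  rw [setIntegral_I_eq hb fun t ht hlt => by rw [(hbz t ht hlt).1, zero_mul],
    setIntegral_I_eq hb fun t ht hlt => by simp only [(hbz t ht hlt).2, zero_mul]]
  obtain ⟨L, hL⟩ := hψ.lipschitzWith_of_hasCompactSupport hψc (by simp)
  rw [AbsolutelyContinuousOnInterval.integral_mul_deriv_eq_deriv_mul
    (hK.lipschitzOnWith.absolutelyContinuousOnInterval)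
    (hL.lipschitzOnWith.absolutelyContinuousOnInterval)]
  have h0 : ψ 0 = 0 := image_eq_zero_of_notMem_tsupport fun hm => zero_notMem_interior_I e (hψI hm)
  have h1 : G.res φ e b * ψ b = 0 := by
    by_cases hl : G.len e = ⊤
    · rw [hbt hl, zero_mul]
    · have : ψ b = 0 := image_eq_zero_of_notMem_tsupport fun hm =>
        toReal_len_notMem_interior_I hl (hbl hl ▸ hψI hm)
      rw [this, mul_zero]
  rw [h0, h1]
  ring

theorem IsTest.memH1 (hG : G.IsConnected) {φ : G.Point → ℝ} (hφ : G.IsTest φ) : G.MemH1 φ :=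
  ⟨hφ.continuous, hφ.memLp_res hG, _, hφ.isWeakDeriv hG⟩

theorem IsTest.hasCompactSupport [Finite E] [Nonempty E] (hG : G.IsConnected) {φ : G.Point → ℝ}
    (hφ : G.IsTest φ) : HasCompactSupport φ := by
  obtain ⟨x, r, h⟩ := hφ.support
  refine (isCompact_closedBall hG x r).of_isClosed_subset (isClosed_tsupport φ) ?_
  exact closure_minimal (fun y hy => h y hy) (isClosed_closedBall hG x r)

/-- Fundamental lemma of the calculus of variations. Since `weakDeriv` is an arbitrary choice, this
is what allows `Q` to be computed with `deriv`. -/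
theorem IsWeakDeriv.ae_eq {φ : G.Point → ℝ} {g₁ g₂ : E → ℝ → ℝ} (h₁ : G.IsWeakDeriv φ g₁)
    (h₂ : G.IsWeakDeriv φ g₂) (e : E) : g₁ e =ᵐ[volume.restrict (G.I e)] g₂ e := by
  have hsub : MemLp (g₁ e - g₂ e) 2 (volume.restrict (G.I e)) := (h₁ e).1.sub (h₂ e).1
  have hloc : LocallyIntegrableOn (g₁ e - g₂ e) (interior (G.I e)) :=
    (locallyIntegrableOn_of_locallyIntegrable_restrict
      (hsub.locallyIntegrable (by norm_num))).mono_set interior_subset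
  have key := isOpen_interior.ae_eq_zero_of_integral_contDiff_smul_eq_zero hloc
    fun ψ hψ hψc hψI => ?_
  · filter_upwards [ae_restrict_of_ae key, ae_mem_interior_I e] with t h hI
    exact sub_eq_zero.1 (h hI)
  · have hψ2 : MemLp ψ 2 (volume.restrict (G.I e)) :=
      (hψ.continuous.memLp_of_hasCompactSupport hψc).restrict _
    have hvan : ∀ t ∉ G.I e, ψ t • (g₁ e - g₂ e) t = 0 := fun t ht => by
      rw [image_eq_zero_of_notMem_tsupport fun hm => ht (interior_subset (hψI hm)), zero_smul]
    rw [← setIntegral_eq_integral_of_forall_compl_eq_zero hvan]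
    have e1 := (h₁ e).2 ψ hψ hψc hψI
    have e2 := (h₂ e).2 ψ hψ hψc hψI
    have i1 : Integrable (fun t => g₁ e t * ψ t) (volume.restrict (G.I e)) :=
      (h₁ e).1.integrable_mul hψ2
    have i2 : Integrable (fun t => g₂ e t * ψ t) (volume.restrict (G.I e)) :=
      (h₂ e).1.integrable_mul hψ2
    have : ∀ t, ψ t • (g₁ e - g₂ e) t = g₁ e t * ψ t - g₂ e t * ψ t := fun t => by
      simp only [smul_eq_mul, Pi.sub_apply]; ring
    simp_rw [this]
    rw [integral_sub i1 i2]
    linarith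

theorem IsTest.weakDeriv_ae_eq (hG : G.IsConnected) {φ : G.Point → ℝ} (hφ : G.IsTest φ) (e : E) :
    G.weakDeriv φ e =ᵐ[volume.restrict (G.I e)] deriv (G.res φ e) := by
  have h : ∃ g, G.IsWeakDeriv φ g := ⟨_, hφ.isWeakDeriv hG⟩
  have h' : G.IsWeakDeriv φ (G.weakDeriv φ) := by
    simp only [weakDeriv, dif_pos h]
    exact h.choose_spec
  exact h'.ae_eq (hφ.isWeakDeriv hG) e

theorem IsTest.Q_eq [Fintype E] (hG : G.IsConnected) {φ : G.Point → ℝ} (hφ : G.IsTest φ)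
    (p lam rho : ℝ) (U : G.Point → ℝ) :
    G.Q p lam rho U φ = ∑ e, ∫ t in G.I e, ((deriv (G.res φ e) t) ^ 2 +
      (lam - (p - 1) * rho * |G.res U e t| ^ (p - 2)) * (G.res φ e t) ^ 2) := by
  refine Finset.sum_congr rfl fun e _ => integral_congr_ae ?_
  filter_upwards [hφ.weakDeriv_ae_eq hG e] with t ht
  rw [ht]

end TestFunctions

end MetricGraph

/-! ### Positive solutions on an interval: energy bounds and comparison. -/

section ODE

theorem energy_eq {u v : ℝ → ℝ} {a b p lam rho : ℝ} (hp : p ≠ 0)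
    (hu : ∀ t ∈ Set.Icc a b, HasDerivWithinAt u (v t) (Set.Icc a b) t)
    (hv : ∀ t ∈ Set.Icc a b,
      HasDerivWithinAt v (lam * u t - rho * u t ^ (p - 1)) (Set.Icc a b) t)
    (hpos : ∀ t ∈ Set.Icc a b, 0 < u t) {t : ℝ} (ht : t ∈ Set.Icc a b) :
    v t ^ 2 / 2 + rho * u t ^ p / p - lam * u t ^ 2 / 2 =
      v a ^ 2 / 2 + rho * u a ^ p / p - lam * u a ^ 2 / 2 := by
  have hd : ∀ t ∈ Set.Icc a b, HasDerivWithinAt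
      (fun t => v t ^ 2 / 2 + rho * u t ^ p / p - lam * u t ^ 2 / 2) 0 (Set.Icc a b) t := by
    intro t ht
    have h := ((((hv t ht).pow 2).div_const 2).add
      ((((hu t ht).rpow_const (p := p) (.inl (hpos t ht).ne')).const_mul rho).div_const p)).sub
      ((((hu t ht).pow 2).const_mul lam).div_const 2)
    refine h.congr_deriv ?_
    field_simp
    ring
  rcases lt_or_ge a b with hab | hab
  · refine constant_of_derivWithin_zero (fun t ht => (hd t ht).differentiableWithinAt)
      (fun t ht => ?_) t ht
    exact (hd t (Set.Ico_subset_Icc_self ht)).derivWithin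
      (uniqueDiffOn_Icc hab t (Set.Ico_subset_Icc_self ht))
  · rw [le_antisymm (ht.2.trans hab) ht.1]

/-- Positive solutions on long intervals have small energy: the logarithmic derivative of a
solution of large energy satisfies a Riccati inequality which cannot hold for long. -/
theorem energy_le {u v : ℝ → ℝ} {a b p lam rho U : ℝ} (hp : 2 < p) (hlam : 0 < lam)
    (hrho : 1 / 2 ≤ rho) (hab : a < b) (hlong : 1 ≤ lam * (b - a) ^ 2) (hU : 0 < U)
    (hU' : U ^ (p - 2) = 84 * lam)
    (hu : ∀ t ∈ Set.Icc a b, HasDerivWithinAt u (v t) (Set.Icc a b) t)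
    (hv : ∀ t ∈ Set.Icc a b,
      HasDerivWithinAt v (lam * u t - rho * u t ^ (p - 1)) (Set.Icc a b) t)
    (hpos : ∀ t ∈ Set.Icc a b, 0 < u t) :
    v a ^ 2 / 2 + rho * u a ^ p / p - lam * u a ^ 2 / 2 ≤ 21 * lam * U ^ 2 := by
  by_contra! hH
  set H := v a ^ 2 / 2 + rho * u a ^ p / p - lam * u a ^ 2 / 2 with hHdef
  obtain ⟨c, hc0, hc⟩ : ∃ c : ℝ, 0 < c ∧ c ^ 2 = 41 * lam :=
    ⟨√(41 * lam), by positivity, Real.sq_sqrt (by positivity)⟩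
  -- With `w = v / u` and `y = u ^ (p - 2)`, conservation of `H` rewrites `w' = lam - rho * y - w ^
  -- 2` as `-w ^ 2 / 2 + lam / 2 - rho * y * (1 - 1 / p) - H / u ^ 2`. One of the last two terms is
  -- always large: `y / 4 ≥ 21 * lam` if `u ≥ U`, and `H / u ^ 2 ≥ 21 * lam` if `u ≤ U`.
  have key : ∀ t ∈ Set.Icc a b,
      (lam * u t - rho * u t ^ (p - 1)) / u t - (v t / u t) ^ 2 ≤
        -(((v t / u t) ^ 2 + c ^ 2) / 2) := by
    intro t ht
    have hut := hpos t ht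
    have hE := energy_eq (by linarith) hu hv hpos ht
    rw [← hHdef] at hE
    have e1 : u t ^ (p - 1) = u t ^ (p - 2) * u t := by
      rw [← Real.rpow_add_one hut.ne']; ring_nf
    have e2 : u t ^ p = u t ^ (p - 2) * u t ^ 2 := by
      rw [← Real.rpow_add_natCast hut.ne']; norm_num
    set y := u t ^ (p - 2) with hy
    have hy0 : 0 < y := Real.rpow_pos_of_pos hut _
    set w := v t / u t with hw
    have hvw : v t = w * u t := by rw [hw]; field_simp
    have h1 : (lam * u t - rho * u t ^ (p - 1)) / u t = lam - rho * y := by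
      rw [e1]; field_simp
    have h2 : H / u t ^ 2 = w ^ 2 / 2 + rho * y / p - lam / 2 := by
      rw [← hE, e2, hvw]; field_simp
    have h3 : 21 * lam ≤ y / 4 + H / u t ^ 2 := by
      have hHpos : 0 < H := lt_trans (by positivity) hH
      rcases le_total (u t) U with hle | hle
      · have : 21 * lam ≤ H / u t ^ 2 := by
          rw [le_div_iff₀ (by positivity)]
          have : u t ^ 2 ≤ U ^ 2 := by gcongr
          nlinarith
        linarith
      · have : U ^ (p - 2) ≤ y := Real.rpow_le_rpow hU.le hle (by linarith)
        have : 0 < H / u t ^ 2 := by positivity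
        linarith
    have h4 : rho * y / p ≤ rho * y / 2 := by gcongr
    have h5 : y / 4 ≤ rho * y / 2 := by nlinarith
    rw [h1, hc]
    linarith
  -- `w' ≤ -(w ^ 2 + c ^ 2) / 2` means that `arctan (w / c)` decreases at rate at least `c / 2`; its
  -- range has length `π`, so `c * (b - a) < 2π`.
  set f : ℝ → ℝ := fun t => Real.arctan (v t / u t / c) + c / 2 * t with hf
  have hderiv : ∀ t ∈ Set.Icc a b, HasDerivWithinAt f
      (1 / (1 + (v t / u t / c) ^ 2) *
        (((lam * u t - rho * u t ^ (p - 1)) * u t - v t * v t) / u t ^ 2 / c) + c / 2)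
      (Set.Icc a b) t := fun t ht => by
    have := ((((hv t ht).div (hu t ht) (hpos t ht).ne').div_const c).arctan).add
      ((hasDerivWithinAt_id t _).const_mul (c / 2))
    exact this.congr_deriv (by simp)
  have hanti : AntitoneOn f (Set.Icc a b) := by
    refine antitoneOn_of_hasDerivWithinAt_nonpos (convex_Icc a b)
      (fun t ht => (hderiv t ht).continuousWithinAt)
      (fun t ht => (hderiv t (interior_subset ht)).mono interior_subset) fun t ht => ?_
    have ht' := interior_subset ht
    have hut := hpos t ht'
    have hk := key t ht'
    have e : ((lam * u t - rho * u t ^ (p - 1)) * u t - v t * v t) / u t ^ 2 =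
        (lam * u t - rho * u t ^ (p - 1)) / u t - (v t / u t) ^ 2 := by
      field_simp
    rw [e]
    set w := v t / u t
    have e2 : 1 / (1 + (w / c) ^ 2) = c ^ 2 / (c ^ 2 + w ^ 2) := by field_simp
    rw [e2]
    have h6 : c ^ 2 / (c ^ 2 + w ^ 2) *
        (((lam * u t - rho * u t ^ (p - 1)) / u t - w ^ 2) / c) ≤
        c ^ 2 / (c ^ 2 + w ^ 2) * (-((w ^ 2 + c ^ 2) / 2) / c) := by gcongr
    have h7 : c ^ 2 / (c ^ 2 + w ^ 2) * (-((w ^ 2 + c ^ 2) / 2) / c) = -(c / 2) := by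
      field_simp; ring
    linarith
  have h1 := hanti (Set.left_mem_Icc.2 hab.le) (Set.right_mem_Icc.2 hab.le) hab.le
  simp only [hf] at h1
  have h2 := Real.arctan_lt_pi_div_two (v a / u a / c)
  have h3 := Real.neg_pi_div_two_lt_arctan (v b / u b / c)
  have h4 : c * (b - a) < 2 * Real.pi := by linarith
  have h5 : (c * (b - a)) ^ 2 < (2 * Real.pi) ^ 2 := by
    have : 0 < c * (b - a) := mul_pos hc0 (sub_pos.2 hab)
    gcongr
  rw [mul_pow, hc] at h5
  have h6 := Real.pi_lt_d2
  have h7 := Real.pi_pos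
  -- `(c * (b - a)) ^ 2 ≥ 41`, whereas `(2π) ^ 2 < 4 * 3.15 ^ 2 < 40`.
  nlinarith

/-- The extra factor `p` in `U ^ (p - 2)` gives `rho * u ^ p / p ≥ 42 * lam * u ^ 2` wherever `u >
U`, so the potential part of the energy alone would exceed the bound of `energy_le`. The bound on
`v` is then read off from the same energy. -/
theorem solution_le {u v : ℝ → ℝ} {a b p lam rho U : ℝ} (hp : 2 < p) (hlam : 0 < lam)
    (hrho : 1 / 2 ≤ rho) (hab : a < b) (hlong : 1 ≤ lam * (b - a) ^ 2) (hU : 0 < U)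
    (hU' : U ^ (p - 2) = 84 * p * lam)
    (hu : ∀ t ∈ Set.Icc a b, HasDerivWithinAt u (v t) (Set.Icc a b) t)
    (hv : ∀ t ∈ Set.Icc a b,
      HasDerivWithinAt v (lam * u t - rho * u t ^ (p - 1)) (Set.Icc a b) t)
    (hpos : ∀ t ∈ Set.Icc a b, 0 < u t) {t : ℝ} (ht : t ∈ Set.Icc a b) :
    u t ≤ U ∧ v t ^ 2 ≤ 43 * lam * U ^ 2 := by
  have hp2 : 0 < p - 2 := by linarith
  set U₁ := (84 * lam) ^ (1 / (p - 2)) with hU₁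
  have hU₁0 : 0 < U₁ := by positivity
  have hU₁' : U₁ ^ (p - 2) = 84 * lam := by
    rw [hU₁, ← Real.rpow_mul (by positivity), one_div_mul_cancel hp2.ne', Real.rpow_one]
  have hle : U₁ ≤ U := by
    rw [← Real.rpow_le_rpow_iff hU₁0.le hU.le hp2, hU', hU₁']
    nlinarith
  have h1 := energy_le hp hlam hrho hab hlong hU₁0 hU₁' hu hv hpos
  rw [← energy_eq (by linarith) hu hv hpos ht] at h1
  have h2 : 21 * lam * U₁ ^ 2 ≤ 21 * lam * U ^ 2 := by gcongr
  have hut := hpos t ht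
  have e2 : u t ^ p = u t ^ (p - 2) * u t ^ 2 := by
    rw [← Real.rpow_add_natCast hut.ne']; norm_num
  have h3 : u t ≤ U := by
    by_contra! hlt
    have h4 : 84 * p * lam ≤ u t ^ (p - 2) := hU' ▸ Real.rpow_le_rpow hU.le hlt.le hp2.le
    have h5 : 42 * lam * u t ^ 2 ≤ rho * u t ^ p / p := by
      rw [e2, le_div_iff₀ (by linarith)]
      have : 42 * p * lam ≤ rho * u t ^ (p - 2) := by nlinarith [mul_pos hlam (by linarith : 0 < p)]
      nlinarith [sq_nonneg (u t)]
    have h6 : U ^ 2 < u t ^ 2 := by gcongr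
    nlinarith [sq_nonneg (v t), mul_lt_mul_of_pos_left h6 hlam]
  refine ⟨h3, ?_⟩
  have h7 : 0 ≤ rho * u t ^ p / p := by positivity
  have h8 : lam * u t ^ 2 ≤ lam * U ^ 2 := by gcongr
  linarith

/-- Comparison with the hyperbolic cosine. -/
theorem mul_cosh_le {u v q : ℝ → ℝ} {t r k : ℝ} (hr : 0 ≤ r)
    (hu : ∀ s ∈ Set.Icc (t - r) (t + r), HasDerivWithinAt u (v s) (Set.Icc (t - r) (t + r)) s)
    (hv : ∀ s ∈ Set.Icc (t - r) (t + r), HasDerivWithinAt v (q s) (Set.Icc (t - r) (t + r)) s)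
    (hq : ∀ s ∈ Set.Icc (t - r) (t + r), k ^ 2 * u s ≤ q s) :
    2 * u t * Real.cosh (k * r) ≤ u (t + r) + u (t - r) := by
  have m1 : Set.MapsTo (fun s => t + s) (Set.Icc 0 r) (Set.Icc (t - r) (t + r)) := fun s hs => by
    constructor <;> linarith [hs.1, hs.2]
  have m2 : Set.MapsTo (fun s => t - s) (Set.Icc 0 r) (Set.Icc (t - r) (t + r)) := fun s hs => by
    constructor <;> linarith [hs.1, hs.2]
  have comp1 : ∀ {f f' : ℝ → ℝ}, (∀ s ∈ Set.Icc (t - r) (t + r),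
      HasDerivWithinAt f (f' s) (Set.Icc (t - r) (t + r)) s) → ∀ s ∈ Set.Icc 0 r,
      HasDerivWithinAt (fun s => f (t + s)) (f' (t + s)) (Set.Icc 0 r) s := fun hf s hs => by
    have := (hf _ (m1 hs)).comp s ((hasDerivWithinAt_id s (Set.Icc 0 r)).const_add t) m1
    exact this.congr_deriv (by simp)
  have comp2 : ∀ {f f' : ℝ → ℝ}, (∀ s ∈ Set.Icc (t - r) (t + r),
      HasDerivWithinAt f (f' s) (Set.Icc (t - r) (t + r)) s) → ∀ s ∈ Set.Icc 0 r,
      HasDerivWithinAt (fun s => f (t - s)) (-f' (t - s)) (Set.Icc 0 r) s := fun hf s hs => by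
    have := (hf _ (m2 hs)).comp s ((hasDerivWithinAt_id s (Set.Icc 0 r)).const_sub t) m2
    exact this.congr_deriv (by simp)
  have dy : ∀ s ∈ Set.Icc 0 r, HasDerivWithinAt (fun s => u (t + s) + u (t - s))
      (v (t + s) - v (t - s)) (Set.Icc 0 r) s := fun s hs =>
    ((comp1 hu s hs).add (comp2 hu s hs)).congr_deriv (by ring)
  have dz : ∀ s ∈ Set.Icc 0 r, HasDerivWithinAt (fun s => v (t + s) - v (t - s))
      (q (t + s) + q (t - s)) (Set.Icc 0 r) s := fun s hs =>
    ((comp1 hv s hs).sub (comp2 hv s hs)).congr_deriv (by ring)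
  have dks : ∀ s, HasDerivWithinAt (fun s => k * s) k (Set.Icc 0 r) s := fun s =>
    ((hasDerivWithinAt_id s _).const_mul k).congr_deriv (by simp)
  have dC : ∀ s ∈ Set.Icc 0 r, HasDerivWithinAt (fun s => Real.cosh (k * s))
      (Real.sinh (k * s) * k) (Set.Icc 0 r) s := fun s _ => (dks s).cosh
  have dS : ∀ s ∈ Set.Icc 0 r, HasDerivWithinAt (fun s => Real.sinh (k * s))
      (Real.cosh (k * s) * k) (Set.Icc 0 r) s := fun s _ => (dks s).sinh
  have h0 : (0 : ℝ) ∈ Set.Icc 0 r := Set.left_mem_Icc.2 hr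
  -- Symmetrising about `t` removes the unknown slope there: the Wronskian of `u (t + s) + u (t -
  -- s)` and `cosh (k * s)` vanishes at `0` and is nondecreasing, so the quotient of the two is
  -- nondecreasing.
  have hW : ∀ s ∈ Set.Icc 0 r, 0 ≤ (v (t + s) - v (t - s)) * Real.cosh (k * s) -
      (u (t + s) + u (t - s)) * (k * Real.sinh (k * s)) := by
    have dW : ∀ s ∈ Set.Icc 0 r, HasDerivWithinAt
        (fun s => (v (t + s) - v (t - s)) * Real.cosh (k * s) -
          (u (t + s) + u (t - s)) * (k * Real.sinh (k * s)))
        ((q (t + s) + q (t - s) - k ^ 2 * (u (t + s) + u (t - s))) * Real.cosh (k * s))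
        (Set.Icc 0 r) s := fun s hs =>
      (((dz s hs).mul (dC s hs)).sub ((dy s hs).mul ((dS s hs).const_mul k))).congr_deriv
        (by ring)
    have hmono := monotoneOn_of_hasDerivWithinAt_nonneg (convex_Icc 0 r)
      (fun s hs => (dW s hs).continuousWithinAt)
      (fun s hs => (dW s (interior_subset hs)).mono interior_subset) fun s hs => by
        have hs' := interior_subset hs
        refine mul_nonneg ?_ (Real.cosh_pos _).le
        have e1 := hq _ (m1 hs')
        have e2 := hq _ (m2 hs')
        simp only at e1 e2
        linarith
    intro s hs
    have := hmono h0 hs hs.1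
    simpa using this
  have dY : ∀ s ∈ Set.Icc 0 r, HasDerivWithinAt
      (fun s => (u (t + s) + u (t - s)) / Real.cosh (k * s))
      (((v (t + s) - v (t - s)) * Real.cosh (k * s) -
        (u (t + s) + u (t - s)) * (Real.sinh (k * s) * k)) / Real.cosh (k * s) ^ 2)
      (Set.Icc 0 r) s := fun s hs => (dy s hs).div (dC s hs) (Real.cosh_pos _).ne'
  have hmono := monotoneOn_of_hasDerivWithinAt_nonneg (convex_Icc 0 r)
    (fun s hs => (dY s hs).continuousWithinAt)
    (fun s hs => (dY s (interior_subset hs)).mono interior_subset) fun s hs => by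
      have := hW s (interior_subset hs)
      refine div_nonneg ?_ (sq_nonneg _)
      linarith
  have := hmono h0 (Set.right_mem_Icc.2 hr) hr
  simp only [mul_zero, Real.cosh_zero, add_zero, sub_zero, div_one] at this
  rw [le_div_iff₀ (Real.cosh_pos _)] at this
  linarith

end ODE

namespace MetricGraph

variable {V E : Type*}

/-! ### Solutions on the graph: a priori bounds, integration by parts, cutoffs. -/

section Solutions

variable {G : MetricGraph V E}

/-- The derivative along the edge `e`. -/
noncomputable def dres (G : MetricGraph V E) (u : G.Point → ℝ) (e : E) : ℝ → ℝ :=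
  derivWithin (G.res u e) (G.I e)

theorem lipschitzWith_mul {f g : ℝ → ℝ} {K L : NNReal} (hf : LipschitzWith K f)
    (hg : LipschitzWith L g) {A B : NNReal} (hA : ∀ t, |f t| ≤ A) (hB : ∀ t, |g t| ≤ B) :
    LipschitzWith (A * L + K * B) fun t => f t * g t := by
  refine LipschitzWith.of_dist_le_mul fun s t => ?_
  have h1 := hf.dist_le_mul s t
  have h2 := hg.dist_le_mul s t
  rw [Real.dist_eq] at *
  have e : f s * g s - f t * g t = f s * (g s - g t) + (f s - f t) * g t := by ring
  rw [e]
  refine (abs_add_le _ _).trans ?_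
  rw [abs_mul, abs_mul]
  have h3 : |f s| * |g s - g t| ≤ A * (L * |s - t|) := by
    have := hA s; gcongr; exact h2
  have h4 : |f s - f t| * |g t| ≤ (K * |s - t|) * B := by
    have := hB t; gcongr; exact h1
  rw [Real.dist_eq]
  push_cast
  linarith

theorem IsTest.mul_of_bounded {φ : G.Point → ℝ} (hφ : G.IsTest φ) {C : ℝ} (hC : ∀ x, |φ x| ≤ C)
    {f : G.Point → ℝ} {U : ℝ} (hf : ∀ e, ∃ K, LipschitzWith K (G.res f e))
    (hU : ∀ x, |f x| ≤ U) : G.IsTest fun x => f x * φ x := by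
  constructor
  · intro e
    obtain ⟨K, hK⟩ := hf e
    obtain ⟨L, hL⟩ := hφ.lipschitz e
    have hU0 := (abs_nonneg _).trans (hU (G.pt e 0))
    have hC0 := (abs_nonneg _).trans (hC (G.pt e 0))
    exact ⟨_, lipschitzWith_mul (A := ⟨U, hU0⟩) (B := ⟨C, hC0⟩) hK hL (fun t => hU _) fun t => hC _⟩
  · obtain ⟨x, r, h⟩ := hφ.support
    exact ⟨x, r, fun y hy => h y fun h0 => hy (by simp [h0])⟩

theorem pow_split {y p : ℝ} (hy : 0 < y) : y ^ (p - 1) = y ^ (p - 2) * y := by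
  rw [← Real.rpow_add_one hy.ne']; ring_nf

section

variable [Fintype E] {p lam rho : ℝ} {u : G.Point → ℝ}

theorem IsPositiveSolution.res_pos (hu : G.IsPositiveSolution p lam rho u) (e : E) (t : ℝ) :
    0 < G.res u e t := hu.pos _

theorem IsPositiveSolution.continuous_res (hu : G.IsPositiveSolution p lam rho u) (e : E) :
    Continuous (G.res u e) := continuous_iff_res.1 hu.memH1.1 e

theorem IsPositiveSolution.hasDerivWithinAt (hu : G.IsPositiveSolution p lam rho u) {e : E}
    {t : ℝ} (ht : t ∈ G.I e) :
    HasDerivWithinAt (G.res u e) (G.dres u e t) (G.I e) t :=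
  ((hu.contDiffOn e).differentiableOn (by norm_num) t ht).hasDerivWithinAt

theorem IsPositiveSolution.hasDerivWithinAt_dres (hu : G.IsPositiveSolution p lam rho u) {e : E}
    {t : ℝ} (ht : t ∈ G.I e) :
    HasDerivWithinAt (G.dres u e) (lam * G.res u e t - rho * G.res u e t ^ (p - 1))
      (G.I e) t := by
  have h1 : ContDiffOn ℝ 1 (G.dres u e) (G.I e) :=
    (hu.contDiffOn e).derivWithin (uniqueDiffOn_I e) (by norm_num)
  have h2 := (h1.differentiableOn (by norm_num) t ht).hasDerivWithinAt
  have h3 := hu.eqn e t ht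
  have h4 : iteratedDerivWithin 2 (G.res u e) (G.I e) t =
      derivWithin (G.dres u e) (G.I e) t := by
    rw [iteratedDerivWithin_succ]
    rw [iteratedDerivWithin_one]
    rfl
  rw [h4] at h3
  exact h2.congr_deriv (by linarith)

theorem IsPositiveSolution.bounds (hp : 2 < p) (hlam : 0 < lam) (hrho : 1 / 2 ≤ rho)
    (hlong : ∀ e, G.len e ≠ ⊤ → 1 ≤ lam * (G.len e).toReal ^ 2) {U : ℝ} (hU : 0 < U)
    (hU' : U ^ (p - 2) = 84 * p * lam) (hu : G.IsPositiveSolution p lam rho u) {e : E} {t : ℝ}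
    (ht : t ∈ G.I e) : G.res u e t ≤ U ∧ G.dres u e t ^ 2 ≤ 43 * lam * U ^ 2 := by
  obtain ⟨b, hbI, hb0, htb, hb⟩ : ∃ b ∈ G.I e, 0 < b ∧ t ≤ b ∧ 1 ≤ lam * b ^ 2 := by
    by_cases h : G.len e = ⊤
    -- On a half-line any long enough interval containing `t` will do; `lam * (1 + 1 / lam) ^ 2 ≥
    -- 1`.
    · refine ⟨max t (1 + 1 / lam), ?_, lt_max_of_lt_right (by positivity), le_max_left _ _, ?_⟩
      · rw [I_of_eq_top h]; exact ht.1.trans (le_max_left _ _)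
      · have h1 : 1 + 1 / lam ≤ max t (1 + 1 / lam) := le_max_right _ _
        have h2 : (1 + 1 / lam) ^ 2 ≤ max t (1 + 1 / lam) ^ 2 := by gcongr
        have h3 : lam * (1 + 1 / lam) ^ 2 = lam + 2 + 1 / lam := by field_simp; ring
        have h4 : 0 < 1 / lam := by positivity
        nlinarith
    · refine ⟨_, toReal_len_mem_I h, toReal_len_pos h, ?_, hlong e h⟩
      rw [I_of_ne_top h] at ht; exact ht.2
  have hsub : Set.Icc 0 b ⊆ G.I e := Icc_subset_I (zero_mem_I e) hbI
  exact solution_le hp hlam hrho hb0 (by simpa using hb) hU hU'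
    (fun s hs => (hu.hasDerivWithinAt (hsub hs)).mono hsub)
    (fun s hs => (hu.hasDerivWithinAt_dres (hsub hs)).mono hsub)
    (fun s _ => hu.res_pos e s) ⟨ht.1, htb⟩

theorem lipschitzWith_res_of_abs_dres_le (hu : G.IsPositiveSolution p lam rho u) {e : E}
    {K : NNReal} (hK : ∀ t ∈ G.I e, |G.dres u e t| ≤ K) : LipschitzWith K (G.res u e) := by
  have h : LipschitzOnWith K (G.res u e) (G.I e) :=
    (ordConnected_I e).convex.lipschitzOnWith_of_nnnorm_hasDerivWithin_le
      (fun t ht => hu.hasDerivWithinAt ht) fun t ht => hK t ht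
  refine LipschitzWith.of_dist_le_mul fun s t => ?_
  rw [← res_clamp u e s, ← res_clamp u e t]
  refine (h.dist_le_mul _ (clamp_mem e s) _ (clamp_mem e t)).trans ?_
  gcongr
  exact abs_clamp_sub_clamp_le e s t

/-- The boundary terms of an integration by parts cancel by the Kirchhoff condition. -/
theorem sum_boundary_eq_zero [Fintype V] (hu : G.IsPositiveSolution p lam rho u) (c : V → ℝ)
    (B : E → ℝ) (hB : ∀ e, G.len e ≠ ⊤ → B e = c (G.tgt e) * G.dres u e (G.len e).toReal)
    (hB' : ∀ e, G.len e = ⊤ → B e = 0) :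
    ∑ e, (B e - c (G.src e) * G.dres u e 0) = 0 := by
  classical
  -- The Kirchhoff conditions are weighted by `c v` and the sum is regrouped by edges: a bounded
  -- edge contributes both ends, a half-line only the end `0`.
  have h : ∑ v, c v * G.kirchhoffSum u v = 0 := Finset.sum_eq_zero fun v _ => by
    rw [hu.kirchhoff, mul_zero]
  have h2 : ∑ v, c v * G.kirchhoffSum u v = -∑ e, (B e - c (G.src e) * G.dres u e 0) := by
    simp only [kirchhoffSum, Finset.mul_sum]
    rw [Finset.sum_comm, ← Finset.sum_neg_distrib]
    refine Finset.sum_congr rfl fun e _ => ?_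
    simp only [mul_sub, Finset.sum_sub_distrib, mul_ite, mul_zero, dres]
    rw [Finset.sum_ite_eq]
    by_cases hl : G.len e = ⊤
    · simp [hl, hB' e hl]
    · simp only [hl, ne_eq, not_false_eq_true, and_true, Finset.sum_ite_eq, Finset.mem_univ, if_true,
        hB e hl, dres]
      ring
  linarith

/-- By the equation the integrand is almost everywhere the derivative of `u * η ^ 2 * u'`, which is
absolutely continuous. The outer boundary value `B` has the form that `sum_boundary_eq_zero`
requires. -/
theorem integral_edge_eq (hG : G.IsConnected) (hu : G.IsPositiveSolution p lam rho u)
    {η : G.Point → ℝ} (hη : G.IsTest η) (e : E) (hlip : ∃ K, LipschitzWith K (G.res u e)) :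
    ∃ B, (G.len e ≠ ⊤ → B = u (.vertex (G.tgt e)) * η (.vertex (G.tgt e)) ^ 2 *
        G.dres u e (G.len e).toReal) ∧ (G.len e = ⊤ → B = 0) ∧
      ∫ t in G.I e, ((deriv (G.res (fun x => u x * η x) e) t) ^ 2
        - G.res u e t ^ 2 * (deriv (G.res η e) t) ^ 2
        + (lam - rho * |G.res u e t| ^ (p - 2)) * (G.res (fun x => u x * η x) e t) ^ 2) =
      B - u (.vertex (G.src e)) * η (.vertex (G.src e)) ^ 2 * G.dres u e 0 := by
  obtain ⟨S, hS, hS'⟩ := hη.exists_compact hG e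
  obtain ⟨L, hL⟩ := hη.lipschitz e
  obtain ⟨K, hK⟩ := hlip
  obtain ⟨b, hb, hbl, hbt, hbz⟩ := exists_end hS hS'
  have hsub : Set.Icc 0 b ⊆ G.I e := Icc_subset_I (zero_mem_I e) hb
  set f := G.res u e with hf
  set g := G.res η e with hg
  have hfg : G.res (fun x => u x * η x) e = fun t => f t * g t := rfl
  have hfpos : ∀ t, 0 < f t := hu.res_pos e
  have hdf : AbsolutelyContinuousOnInterval (G.dres u e) 0 b := by
    obtain ⟨C, hC⟩ := (isCompact_Icc (a := (0 : ℝ)) (b := b)).exists_bound_of_continuousOn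
      (f := fun t => lam * f t - rho * f t ^ (p - 1)) (by
        refine Continuous.continuousOn ?_
        have hc := hu.continuous_res e
        exact (hc.const_mul _).sub
          ((hc.rpow_const fun t => .inl (hfpos t).ne').const_mul _))
    have : LipschitzOnWith C.toNNReal (G.dres u e) (Set.Icc 0 b) :=
      (convex_Icc 0 b).lipschitzOnWith_of_nnnorm_hasDerivWithin_le
        (fun t ht => (hu.hasDerivWithinAt_dres (hsub ht)).mono hsub) fun t ht => by
          rw [← NNReal.coe_le_coe, coe_nnnorm]
          exact (hC t ht).trans (Real.le_coe_toNNReal C)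
    rw [← Set.uIcc_of_le hb.1] at this
    exact this.absolutelyContinuousOnInterval
  have hAC : AbsolutelyContinuousOnInterval (fun t => f t * (g t * g t) * G.dres u e t) 0 b := by
    have h1 := hK.lipschitzOnWith (s := Set.uIcc 0 b) |>.absolutelyContinuousOnInterval
    have h2 := hL.lipschitzOnWith (s := Set.uIcc 0 b) |>.absolutelyContinuousOnInterval
    exact (h1.fun_mul (h2.fun_mul h2)).fun_mul hdf
  have key := hAC.integral_deriv_eq_sub
  refine ⟨f b * (g b * g b) * G.dres u e b, fun h => ?_, fun h => ?_, ?_⟩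
  · rw [hbl h, hf, hg]
    simp only [res, pt_toReal_len h]
    ring
  · rw [hbt h]; ring
  · rw [setIntegral_I_eq hb, hfg]
    · have e0 : u (.vertex (G.src e)) * η (.vertex (G.src e)) ^ 2 * G.dres u e 0 =
          f 0 * (g 0 * g 0) * G.dres u e 0 := by
        simp only [hf, hg, res, pt_zero]; ring
      rw [e0, ← key, intervalIntegral.integral_of_le hb.1, intervalIntegral.integral_of_le hb.1,
        ← restrict_Ioo_eq_restrict_Ioc]
      refine integral_congr_ae ?_
      filter_upwards [ae_restrict_mem measurableSet_Ioo,
        ae_restrict_of_ae hL.ae_differentiableAt_real] with t ht hgt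
      have hnhds : G.I e ∈ 𝓝 t :=
        Filter.mem_of_superset (Icc_mem_nhds ht.1 ht.2) hsub
      have htI := hsub (Set.Ioo_subset_Icc_self ht)
      have d1 : HasDerivAt f (G.dres u e t) t := (hu.hasDerivWithinAt htI).hasDerivAt hnhds
      have d2 := (hu.hasDerivWithinAt_dres htI).hasDerivAt hnhds
      have d3 : HasDerivAt g (deriv g t) t := hgt.hasDerivAt
      rw [(d1.fun_mul d3).deriv, ((d1.fun_mul (d3.fun_mul d3)).fun_mul d2).deriv,
        abs_of_pos (hfpos t), ← hf, pow_split (hfpos t)]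
      ring
    · intro t ht hlt
      have hfg' : deriv (fun t => f t * g t) t = 0 := by
        have ht0 : t ∈ interior (G.I e) := by
          refine mem_interior_I_of_top ?_ (hb.1.trans_lt hlt)
          by_contra h
          rw [hbl h] at hlt
          rw [I_of_ne_top h] at ht
          exact absurd ht.2 (not_le.2 hlt)
        have : (fun t => f t * g t) =ᶠ[𝓝 t] fun _ => 0 := by
          filter_upwards [isOpen_interior.mem_nhds ht0, lt_mem_nhds hlt] with s hs1 hs2
          rw [(hbz s (interior_subset hs1) hs2).1, mul_zero]
        rw [this.deriv_eq, deriv_const]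
      simp only [hfg, hfg', (hbz t ht hlt).1, (hbz t ht hlt).2]
      ring

end

/-- A cutoff function: `1` on the ball of radius `r`, and `0` outside the ball of radius `2 r`. -/
noncomputable def cutoff (G : MetricGraph V E) (x : G.Point) (r : ℝ) (y : G.Point) : ℝ :=
  max 0 (min 1 (2 - G.dist y x / r))

theorem cutoff_nonneg (x : G.Point) (r : ℝ) (y : G.Point) : 0 ≤ G.cutoff x r y := le_max_left _ _

theorem cutoff_le_one (x : G.Point) (r : ℝ) (y : G.Point) : G.cutoff x r y ≤ 1 :=
  max_le zero_le_one (min_le_left _ _)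

theorem cutoff_eq_one {x : G.Point} {r : ℝ} (hr : 0 < r) {y : G.Point} (h : G.dist y x ≤ r) :
    G.cutoff x r y = 1 := by
  have : G.dist y x / r ≤ 1 := (div_le_one hr).2 h
  unfold cutoff
  rw [min_eq_left (by linarith), max_eq_right zero_le_one]

theorem dist_le_of_cutoff_ne_zero {x : G.Point} {r : ℝ} (hr : 0 < r) {y : G.Point}
    (h : G.cutoff x r y ≠ 0) : G.dist y x ≤ 2 * r := by
  by_contra! hlt
  have : 2 < G.dist y x / r := (lt_div_iff₀ hr).2 hlt
  exact h (max_eq_left ((min_le_right _ _).trans (by linarith)))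

theorem lipschitzWith_cutoff (hG : G.IsConnected) (x : G.Point) {r : ℝ} (hr : 0 < r) (e : E) :
    LipschitzWith (1 / r).toNNReal (G.res (G.cutoff x r) e) := by
  refine LipschitzWith.of_dist_le_mul fun s t => ?_
  have h1 := (lipschitzWith_dist hG x e).dist_le_mul s t
  rw [Real.dist_eq, Real.dist_eq] at *
  simp only [res, cutoff] at *
  have h2 := abs_max_sub_max_le_abs (min 1 (2 - G.dist (G.pt e s) x / r))
    (min 1 (2 - G.dist (G.pt e t) x / r)) 0
  have h3 := abs_min_sub_min_le_max 1 (2 - G.dist (G.pt e s) x / r) 1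
    (2 - G.dist (G.pt e t) x / r)
  rw [max_comm 0, max_comm 0]
  refine h2.trans (h3.trans (max_le ?_ ?_))
  · simp only [sub_self, abs_zero]
    exact mul_nonneg NNReal.zero_le_coe (abs_nonneg _)
  · rw [sub_sub_sub_cancel_left, ← sub_div, abs_div, abs_of_pos hr, abs_sub_comm]
    rw [Real.coe_toNNReal _ (by positivity), div_mul_eq_mul_div, one_mul]
    exact div_le_div_of_nonneg_right (by simpa using h1) hr.le

theorem isTest_cutoff (hG : G.IsConnected) (x : G.Point) {r : ℝ} (hr : 0 < r) :
    G.IsTest (G.cutoff x r) :=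
  ⟨fun e => ⟨_, lipschitzWith_cutoff hG x hr e⟩, x, 2 * r,
    fun _ hy => dist_le_of_cutoff_ne_zero hr hy⟩

theorem abs_cutoff_le_one (x : G.Point) (r : ℝ) (y : G.Point) : |G.cutoff x r y| ≤ 1 := by
  rw [abs_of_nonneg (cutoff_nonneg x r y)]; exact cutoff_le_one x r y

end Solutions

/-! ### Negative directions of the quadratic form. -/

section Morse

variable {G : MetricGraph V E}

theorem IsTest.integrable_integrand (hG : G.IsConnected) {φ : G.Point → ℝ} (hφ : G.IsTest φ)
    (e : E) {c : ℝ → ℝ} (hc : Continuous c) {C : ℝ} (hC : ∀ t, |c t| ≤ C) :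
    Integrable (fun t => c t * (G.res φ e t) ^ 2) (volume.restrict (G.I e)) :=
  (hφ.memLp_res hG e).integrable_sq.bdd_mul hc.aestronglyMeasurable (ae_of_all _ hC)

theorem IsTest.integrable_form (hG : G.IsConnected) {φ : G.Point → ℝ} (hφ : G.IsTest φ)
    (e : E) {c : ℝ → ℝ} (hc : Continuous c) {C : ℝ} (hC : ∀ t, |c t| ≤ C) :
    Integrable (fun t => (deriv (G.res φ e) t) ^ 2 + c t * (G.res φ e t) ^ 2)
      (volume.restrict (G.I e)) :=
  (hφ.memLp_deriv hG e).integrable_sq.add (hφ.integrable_integrand hG e hc hC)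

theorem IsTest.zero [Nonempty E] : G.IsTest 0 := by
  obtain ⟨e⟩ := ‹Nonempty E›
  exact ⟨fun _ => ⟨0, LipschitzWith.const 0⟩, .vertex (G.src e), 0, fun _ h => absurd rfl h⟩

theorem IsTest.add (hG : G.IsConnected) {φ ψ : G.Point → ℝ} (hφ : G.IsTest φ) (hψ : G.IsTest ψ) :
    G.IsTest (φ + ψ) := by
  constructor
  · intro e
    obtain ⟨K, hK⟩ := hφ.lipschitz e
    obtain ⟨L, hL⟩ := hψ.lipschitz e
    exact ⟨K + L, hK.add hL⟩
  · obtain ⟨x, r, hx⟩ := hφ.support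
    obtain ⟨y, s, hy⟩ := hψ.support
    refine ⟨x, max r (s + G.dist y x), fun z hz => ?_⟩
    by_cases h : φ z = 0
    · have h' : ψ z ≠ 0 := fun h' => hz (by simp [h, h'])
      exact (dist_triangle hG z y x).trans
        ((add_le_add_left (hy z h') _).trans (le_max_right _ _))
    · exact (hx z h).trans (le_max_left _ _)

theorem IsTest.smul {φ : G.Point → ℝ} (hφ : G.IsTest φ) (c : ℝ) : G.IsTest (c • φ) := by
  constructor
  · intro e
    obtain ⟨K, hK⟩ := hφ.lipschitz e
    refine ⟨‖c‖₊ * K, LipschitzWith.of_dist_le_mul fun s t => ?_⟩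
    have := hK.dist_le_mul s t
    rw [Real.dist_eq] at *
    change |c * G.res φ e s - c * G.res φ e t| ≤ _
    rw [← mul_sub, abs_mul]
    push_cast
    rw [mul_assoc, Real.norm_eq_abs]
    gcongr
  · obtain ⟨x, r, hx⟩ := hφ.support
    exact ⟨x, r, fun y hy => hx y fun h => hy (by simp [h])⟩

theorem IsTest.sum_smul [Nonempty E] (hG : G.IsConnected) {ι : Type*} {φ : ι → G.Point → ℝ}
    (hφ : ∀ i, G.IsTest (φ i)) (c : ι → ℝ) (s : Finset ι) : G.IsTest (∑ i ∈ s, c i • φ i) :=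
  Finset.sum_induction _ G.IsTest (fun _ _ => IsTest.add hG) .zero fun i _ => (hφ i).smul (c i)

theorem sq_sum_of_mul_eq_zero {ι : Type*} {s : Finset ι} {a : ι → ℝ}
    (h : ∀ i j, i ≠ j → a i * a j = 0) : (∑ i ∈ s, a i) ^ 2 = ∑ i ∈ s, a i ^ 2 := by
  rw [sq, Finset.sum_mul_sum]
  refine Finset.sum_congr rfl fun i hi => ?_
  rw [Finset.sum_eq_single i (fun j _ hj => h i j hj.symm) fun hn => absurd hi hn, sq]

/-- Almost everywhere at most one summand has a nonzero value or derivative, so the cross terms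
vanish. Closedness of `Z i` takes care of the derivatives: off `Z i` the function vanishes on a
whole neighbourhood. -/
theorem Q_sum_smul [Fintype E] [Nonempty E] (hG : G.IsConnected) {ι : Type*} [Fintype ι]
    {φ : ι → G.Point → ℝ} (hφ : ∀ i, G.IsTest (φ i)) {Z : ι → Set G.Point}
    (hZ : ∀ i, IsClosed (Z i)) (hdisj : ∀ i j, i ≠ j → Disjoint (Z i) (Z j))
    (hφZ : ∀ i x, φ i x ≠ 0 → x ∈ Z i) (p lam rho : ℝ) {U : G.Point → ℝ}
    (hc : ∀ e, Continuous fun t => lam - (p - 1) * rho * |G.res U e t| ^ (p - 2)) {C : ℝ}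
    (hC : ∀ e t, |lam - (p - 1) * rho * |G.res U e t| ^ (p - 2)| ≤ C) (c : ι → ℝ) :
    G.Q p lam rho U (∑ i, c i • φ i) = ∑ i, c i ^ 2 * G.Q p lam rho U (φ i) := by
  rw [(IsTest.sum_smul hG hφ c Finset.univ).Q_eq hG]
  simp_rw [(hφ _).Q_eq hG, Finset.mul_sum]
  rw [Finset.sum_comm]
  refine Finset.sum_congr rfl fun e _ => ?_
  simp_rw [← integral_const_mul]
  rw [← integral_finsetSum _ fun i _ =>
    ((hφ i).integrable_form hG e (hc e) (hC e)).const_mul _]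
  refine integral_congr_ae ?_
  have hdiff : ∀ᵐ t ∂volume.restrict (G.I e), ∀ i, DifferentiableAt ℝ (G.res (φ i) e) t :=
    ae_all_iff.2 fun i => ae_restrict_of_ae ((hφ i).lipschitz e).choose_spec.ae_differentiableAt_real
  filter_upwards [hdiff] with t ht
  have hres : G.res (∑ i, c i • φ i) e = fun t => ∑ i, c i * G.res (φ i) e t := by
    ext s
    simp [res, Finset.sum_apply]
  have hz : ∀ i, G.pt e t ∉ Z i → G.res (φ i) e t = 0 ∧ deriv (G.res (φ i) e) t = 0 := by
    intro i hi
    have hev : G.res (φ i) e =ᶠ[𝓝 t] fun _ => 0 := by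
      filter_upwards [((hZ i).isOpen_compl.preimage (continuous_pt e)).mem_nhds hi] with s hs
      by_contra hne
      exact hs (hφZ i _ hne)
    exact ⟨hev.eq_of_nhds, by rw [hev.deriv_eq, deriv_const]⟩
  have hmul : ∀ a : ι → ℝ, (∀ i, G.pt e t ∉ Z i → a i = 0) →
      ∀ i j, i ≠ j → (c i * a i) * (c j * a j) = 0 := by
    intro a ha i j hij
    by_cases hi : G.pt e t ∈ Z i
    · rw [ha j (Set.disjoint_left.1 (hdisj i j hij) hi)]; ring
    · rw [ha i hi]; ring
  have hd : deriv (G.res (∑ i, c i • φ i) e) t = ∑ i, c i * deriv (G.res (φ i) e) t := by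
    rw [hres]
    exact (HasDerivAt.fun_sum fun i _ => (ht i).hasDerivAt.const_mul (c i)).deriv
  rw [hd, hres, sq_sum_of_mul_eq_zero (hmul _ fun i hi => (hz i hi).2),
    sq_sum_of_mul_eq_zero (hmul _ fun i hi => (hz i hi).1), Finset.mul_sum,
    ← Finset.sum_add_distrib]
  refine Finset.sum_congr rfl fun i _ => ?_
  ring

/-- Test functions with disjoint supports and negative energy bound the Morse index below. -/
theorem card_le_morseIndex [Fintype E] [Nonempty E] (hG : G.IsConnected) {ι : Type*} [Fintype ι]
    {φ : ι → G.Point → ℝ} (hφ : ∀ i, G.IsTest (φ i)) {Z : ι → Set G.Point}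
    (hZ : ∀ i, IsClosed (Z i)) (hdisj : ∀ i j, i ≠ j → Disjoint (Z i) (Z j))
    (hφZ : ∀ i x, φ i x ≠ 0 → x ∈ Z i) {p lam rho : ℝ} {U : G.Point → ℝ}
    (hc : ∀ e, Continuous fun t => lam - (p - 1) * rho * |G.res U e t| ^ (p - 2)) {C : ℝ}
    (hC : ∀ e t, |lam - (p - 1) * rho * |G.res U e t| ^ (p - 2)| ≤ C)
    (hneg : ∀ i, G.Q p lam rho U (φ i) < 0) :
    (Fintype.card ι : ℕ∞) ≤ G.morseIndex p lam rho U := by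
  have hQ := Q_sum_smul hG hφ hZ hdisj hφZ p lam rho hc hC
  have hlt : ∀ c : ι → ℝ, c ≠ 0 → G.Q p lam rho U (∑ i, c i • φ i) < 0 := fun c hc0 => by
    obtain ⟨j, hj⟩ := Function.ne_iff.1 hc0
    rw [hQ]
    refine Finset.sum_neg' (fun i _ => ?_) ⟨j, Finset.mem_univ j, ?_⟩
    · exact mul_nonpos_of_nonneg_of_nonpos (sq_nonneg _) (hneg i).le
    · exact mul_neg_of_pos_of_neg (sq_pos_of_ne_zero hj) (hneg j)
  have hQ0 : G.Q p lam rho U 0 = 0 := by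
    simpa using hQ 0
  -- A vanishing combination has energy `0`, whereas one with a nonzero coefficient has negative
  -- energy.
  have hli : LinearIndependent ℝ φ := by
    rw [Fintype.linearIndependent_iff]
    intro c h i
    by_contra hne
    have := hlt c fun h0 => hne (congrFun h0 i)
    rw [h, hQ0] at this
    exact lt_irrefl _ this
  let W := Submodule.span ℝ (Set.range φ)
  have hrank : Cardinal.toENat (Module.rank ℝ W) = Fintype.card ι := by
    have : Module.Finite ℝ W := Module.Finite.span_of_finite ℝ (Set.finite_range φ)
    rw [← Module.finrank_eq_rank, finrank_span_eq_card hli]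
    simp
  rw [← hrank]
  refine le_iSup₂_of_le W (fun ψ hψ => ?_) le_rfl
  obtain ⟨c, rfl⟩ := (Submodule.mem_span_range_iff_exists_fun ℝ).1 hψ
  have ht := IsTest.sum_smul hG hφ c Finset.univ
  exact ⟨ht.memH1 hG, ht.hasCompactSupport hG, fun hne => hlt c fun h0 => hne (by simp [h0])⟩

variable [Fintype E] {p lam rho : ℝ} {u : G.Point → ℝ}

theorem IsPositiveSolution.abs_rpow_le (hp : 2 < p) (hu : G.IsPositiveSolution p lam rho u)
    {U : ℝ} (hU : ∀ x, u x ≤ U) (a b : ℝ) (e : E) (t : ℝ) :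
    |a - b * |G.res u e t| ^ (p - 2)| ≤ |a| + |b| * U ^ (p - 2) := by
  refine (abs_sub _ _).trans (add_le_add_right ?_ _)
  rw [abs_mul]
  have h : |G.res u e t| ≤ U := by rw [abs_of_pos (hu.res_pos e t)]; exact hU _
  rw [abs_of_nonneg (Real.rpow_nonneg (abs_nonneg _) _)]
  gcongr

theorem IsPositiveSolution.continuous_potential (hp : 2 < p)
    (hu : G.IsPositiveSolution p lam rho u) (a b : ℝ) (e : E) :
    Continuous fun t => a - b * |G.res u e t| ^ (p - 2) :=
  continuous_const.sub (((hu.continuous_res e).abs.rpow_const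
    fun _ => .inr (by linarith)).const_mul _)

/-- The equation tested against `u * η ^ 2`; the boundary terms of `integral_edge_eq` cancel by
`sum_boundary_eq_zero`, with weight `u * η ^ 2` at each vertex. -/
theorem sum_integral_eq [Fintype V] (hG : G.IsConnected) (hp : 2 < p)
    (hu : G.IsPositiveSolution p lam rho u) {U : ℝ} (hU : ∀ x, u x ≤ U)
    (hlip : ∀ e, ∃ K, LipschitzWith K (G.res u e)) {η : G.Point → ℝ} (hη : G.IsTest η)
    (hη1 : ∀ x, |η x| ≤ 1) :
    ∑ e, ∫ t in G.I e, ((deriv (G.res (fun x => u x * η x) e) t) ^ 2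
      + (lam - rho * |G.res u e t| ^ (p - 2)) * (G.res (fun x => u x * η x) e t) ^ 2) =
    ∑ e, ∫ t in G.I e, G.res u e t ^ 2 * (deriv (G.res η e) t) ^ 2 := by
  have hφ : G.IsTest fun x => u x * η x := hη.mul_of_bounded hη1 hlip (U := U) fun x => by
    rw [abs_of_pos (hu.pos x)]; exact hU x
  choose B hB1 hB2 hB3 using fun e => integral_edge_eq hG hu hη e (hlip e)
  have h0 := sum_boundary_eq_zero hu (fun v => u (.vertex v) * η (.vertex v) ^ 2) B hB1 hB2
  simp_rw [← hB3] at h0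
  rw [← sub_eq_zero, ← Finset.sum_sub_distrib, ← h0]
  refine Finset.sum_congr rfl fun e _ => ?_
  rw [← integral_sub (hφ.integrable_form hG e (hu.continuous_potential hp lam rho e)
    (hu.abs_rpow_le hp hU lam rho e))]
  · refine integral_congr_ae (ae_of_all _ fun t => ?_)
    simp only
    ring
  · refine (hη.memLp_deriv hG e).integrable_sq.bdd_mul (c := U ^ 2)
      ((hu.continuous_res e).pow 2).aestronglyMeasurable (ae_of_all _ fun t => ?_)
    have h1 := hu.res_pos e t
    have h2 : G.res u e t ≤ U := hU _
    rw [Real.norm_eq_abs, abs_of_nonneg (sq_nonneg _)]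
    gcongr

/-- The slope of the cutoff is at most `1 / r` and lives on a ball of radius `2 * r`, which meets
each edge in length at most `16 * r`. -/
theorem sum_integral_cutoff_le (hG : G.IsConnected) {U : ℝ} (hpos : ∀ x, 0 < u x)
    (hU : ∀ x, u x ≤ U) (x : G.Point) {r : ℝ} (hr : 0 < r) :
    ∑ e, ∫ t in G.I e, G.res u e t ^ 2 * (deriv (G.res (G.cutoff x r) e) t) ^ 2 ≤
      Fintype.card E * (16 * U ^ 2 / r) := by
  rw [← nsmul_eq_mul, ← Finset.card_univ, ← Finset.sum_const]
  refine Finset.sum_le_sum fun e _ => ?_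
  have hU0 : 0 < U := (hpos x).trans_le (hU x)
  have hS := isCompact_ballTrace hG x (2 * r) e
  have hle : ∀ᵐ t ∂volume.restrict (G.I e), G.res u e t ^ 2 *
      (deriv (G.res (G.cutoff x r) e) t) ^ 2 ≤
      (G.ballTrace x (2 * r) e).indicator (fun _ => U ^ 2 / r ^ 2) t := by
    filter_upwards [ae_deriv_eq_zero (f := G.res (G.cutoff x r) e) hS fun t ht hn => by
      by_contra hne
      exact hn ⟨ht, dist_le_of_cutoff_ne_zero hr hne⟩] with t ht
    by_cases h : t ∈ G.ballTrace x (2 * r) e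
    · rw [Set.indicator_of_mem h]
      have h1 := abs_deriv_le_of_lipschitzWith (lipschitzWith_cutoff hG x hr e) t
      rw [Real.coe_toNNReal _ (by positivity)] at h1
      have h2 : (deriv (G.res (G.cutoff x r) e) t) ^ 2 ≤ (1 / r) ^ 2 := by
        rw [← sq_abs]; gcongr
      have h3 : G.res u e t ≤ U := hU _
      have h4 : 0 < G.res u e t := hpos _
      calc _ ≤ U ^ 2 * (1 / r) ^ 2 := by gcongr
        _ = _ := by ring
    · rw [Set.indicator_of_notMem h, ht h]; simp
  calc _ ≤ ∫ t in G.I e, (G.ballTrace x (2 * r) e).indicator (fun _ => U ^ 2 / r ^ 2) t := by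
        refine integral_mono_of_nonneg (ae_of_all _ fun t => by positivity) ?_ hle
        rw [integrable_indicator_iff hS.measurableSet]
        refine integrableOn_const ?_
        exact ((Measure.restrict_apply_le _ _).trans_lt hS.measure_lt_top).ne
    _ = volume.real (G.ballTrace x (2 * r) e) * (U ^ 2 / r ^ 2) := by
        rw [setIntegral_indicator hS.measurableSet, setIntegral_const, smul_eq_mul,
          Set.inter_eq_self_of_subset_right fun t ht => ht.1]
    _ ≤ (8 * (2 * r)) * (U ^ 2 / r ^ 2) := by
        have := volume_ballTrace_le hG x (r := 2 * r) (by positivity) e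
        gcongr
    _ = _ := by field_simp; ring

/-- A lower bound for an integral over the graph of a nonnegative function. -/
theorem le_sum_integral {f : E → ℝ → ℝ} (hf : ∀ e t, 0 ≤ f e t)
    (hfi : ∀ e, Integrable (f e) (volume.restrict (G.I e))) {e : E} {a d c : ℝ} (hd : 0 ≤ d)
    (hsub : Set.Icc a (a + d) ⊆ G.I e) (hc : ∀ t ∈ Set.Icc a (a + d), c ≤ f e t) :
    d * c ≤ ∑ e, ∫ t in G.I e, f e t := by
  calc d * c = ∫ t in Set.Icc a (a + d), c := by
        rw [setIntegral_const, Real.volume_real_Icc_of_le (by linarith)]; simp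
    _ ≤ ∫ t in Set.Icc a (a + d), f e t :=
        setIntegral_mono_on (integrableOn_const (by simp)) ((hfi e).mono_measure
          (Measure.restrict_mono hsub le_rfl)) measurableSet_Icc hc
    _ ≤ ∫ t in G.I e, f e t :=
        setIntegral_mono_set (hfi e) (ae_of_all _ (hf e)) (LE.le.eventuallyLE hsub)
    _ ≤ _ := Finset.single_le_sum (f := fun e => ∫ t in G.I e, f e t)
        (fun e _ => integral_nonneg (hf e)) (Finset.mem_univ e)

/-- If `u` is bounded below on a segment near `x`, a truncation of `u` has negative energy. -/
theorem Q_mul_cutoff_neg [Fintype V] (hG : G.IsConnected) (hp : 2 < p) (hrho : 0 < rho)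
    (hu : G.IsPositiveSolution p lam rho u) {U : ℝ} (hU : ∀ x, u x ≤ U)
    (hlip : ∀ e, ∃ K, LipschitzWith K (G.res u e)) {x : G.Point} {r : ℝ} (hr : 0 < r)
    {e : E} {a d m : ℝ} (hd : 0 ≤ d) (hsub : Set.Icc a (a + d) ⊆ G.I e) (hm : 0 < m)
    (hdist : ∀ t ∈ Set.Icc a (a + d), G.dist (G.pt e t) x ≤ r)
    (hum : ∀ t ∈ Set.Icc a (a + d), m ≤ G.res u e t)
    (hbig : Fintype.card E * (16 * U ^ 2 / r) < (p - 2) * rho * (d * m ^ p)) :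
    G.Q p lam rho u (fun y => u y * G.cutoff x r y) < 0 := by
  have hη := isTest_cutoff hG x hr
  have hφ : G.IsTest fun y => u y * G.cutoff x r y :=
    hη.mul_of_bounded (abs_cutoff_le_one x r) hlip (U := U) fun x => by
      rw [abs_of_pos (hu.pos x)]; exact hU x
  have h1 := sum_integral_eq hG hp hu hU hlip hη (abs_cutoff_le_one x r)
  have h2 := sum_integral_cutoff_le hG hu.pos hU x hr
  rw [← h1] at h2
  have hi : ∀ e, Integrable (fun t => |G.res u e t| ^ (p - 2) *
      (G.res (fun y => u y * G.cutoff x r y) e t) ^ 2) (volume.restrict (G.I e)) := fun e => by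
    refine hφ.integrable_integrand hG e ?_ (C := U ^ (p - 2)) fun t => ?_
    · simpa using hu.continuous_potential hp 0 (-1) e
    · simpa using hu.abs_rpow_le hp hU 0 (-1) e t
  have h3 : d * m ^ p ≤ ∑ e, ∫ t in G.I e, |G.res u e t| ^ (p - 2) *
      (G.res (fun y => u y * G.cutoff x r y) e t) ^ 2 := by
    refine le_sum_integral (fun e t => by positivity) hi hd hsub fun t ht => ?_
    have e1 : G.res (fun y => u y * G.cutoff x r y) e t = G.res u e t := by
      simp only [res]
      rw [cutoff_eq_one hr (hdist t ht), mul_one]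
    have h0 := hu.res_pos e t
    have e2 : G.res u e t ^ p = G.res u e t ^ (p - 2) * G.res u e t ^ 2 := by
      rw [← Real.rpow_add_natCast h0.ne']; norm_num
    rw [e1, abs_of_pos h0, ← e2]
    exact Real.rpow_le_rpow hm.le (hum t ht) (by linarith)
  -- The potential in `Q` differs from that in `sum_integral_eq` by `-(p - 2) * rho * u ^ (p - 2)`,
  -- so only the gradient of the cutoff competes with a negative term.
  have h4 : G.Q p lam rho u (fun y => u y * G.cutoff x r y) =
      (∑ e, ∫ t in G.I e, ((deriv (G.res (fun y => u y * G.cutoff x r y) e) t) ^ 2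
        + (lam - rho * |G.res u e t| ^ (p - 2)) *
          (G.res (fun y => u y * G.cutoff x r y) e t) ^ 2)) -
      (p - 2) * rho * ∑ e, ∫ t in G.I e, |G.res u e t| ^ (p - 2) *
      (G.res (fun y => u y * G.cutoff x r y) e t) ^ 2 := by
    rw [hφ.Q_eq hG, Finset.mul_sum, ← Finset.sum_sub_distrib]
    refine Finset.sum_congr rfl fun e _ => ?_
    rw [← integral_const_mul, ← integral_sub (hφ.integrable_form hG e
      (hu.continuous_potential hp lam rho e) (hu.abs_rpow_le hp hU lam rho e))
      ((hi e).const_mul _)]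
    refine integral_congr_ae (ae_of_all _ fun t => ?_)
    simp only
    ring
  have h5 : (p - 2) * rho * (d * m ^ p) ≤ (p - 2) * rho * ∑ e, ∫ t in G.I e,
      |G.res u e t| ^ (p - 2) * (G.res (fun y => u y * G.cutoff x r y) e t) ^ 2 := by
    have : 0 < p - 2 := by linarith
    gcongr
  rw [h4]
  linarith

/-- A positive solution is somewhere not too small. -/
theorem exists_lt_of_isPositiveSolution [Fintype V] [Nonempty E] (hG : G.IsConnected) (hp : 2 < p)
    (hlam : 0 < lam) (hrho : 0 < rho) (hu : G.IsPositiveSolution p lam rho u) {U : ℝ}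
    (hU : ∀ x, u x ≤ U) (hlip : ∀ e, ∃ K, LipschitzWith K (G.res u e)) {M : ℝ}
    (hM : rho * M ^ (p - 2) ≤ lam / 2) : ∃ x, M < u x := by
  by_contra! hle
  obtain ⟨e⟩ := ‹Nonempty E›
  obtain ⟨b, hb, hb0⟩ : ∃ b ∈ G.I e, 0 < b := by
    by_cases h : G.len e = ⊤
    · exact ⟨1, by rw [I_of_eq_top h]; exact zero_le_one (α := ℝ), one_pos⟩
    · exact ⟨_, toReal_len_mem_I h, toReal_len_pos h⟩
  have hsub : Set.Icc 0 (0 + b) ⊆ G.I e := by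
    rw [zero_add]; exact Icc_subset_I (zero_mem_I e) hb
  obtain ⟨m, hm, hum⟩ : ∃ m > 0, ∀ t ∈ Set.Icc 0 (0 + b), m ≤ G.res u e t := by
    obtain ⟨t₀, _, h⟩ := (isCompact_Icc (a := (0 : ℝ)) (b := 0 + b)).exists_isMinOn
      ⟨0, by simp [hb0.le]⟩ (hu.continuous_res e).continuousOn
    exact ⟨_, hu.res_pos e t₀, h⟩
  set x := G.pt e 0
  have hU0 : 0 < U := (hu.pos x).trans_le (hU x)
  -- If `u ≤ M` everywhere, the form in `sum_integral_eq` is at least `b * (lam / 2 * m ^ 2)` for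
  -- every radius `≥ b`, while the gradient term is `O(1 / r)`. This radius is large enough for a
  -- contradiction.
  set r := b + Fintype.card E * (16 * U ^ 2) / (lam / 2 * (b * m ^ 2)) + 1 with hr_def
  have hr : 0 < r := by positivity
  have hη := isTest_cutoff hG x hr
  have hφ : G.IsTest fun y => u y * G.cutoff x r y :=
    hη.mul_of_bounded (abs_cutoff_le_one x r) hlip (U := U) fun x => by
      rw [abs_of_pos (hu.pos x)]; exact hU x
  have h1 := sum_integral_eq hG hp hu hU hlip hη (abs_cutoff_le_one x r)
  have h2 := sum_integral_cutoff_le hG hu.pos hU x hr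
  rw [← h1] at h2
  have h3 : b * (lam / 2 * m ^ 2) ≤
      ∑ e, ∫ t in G.I e, ((deriv (G.res (fun y => u y * G.cutoff x r y) e) t) ^ 2
        + (lam - rho * |G.res u e t| ^ (p - 2)) *
          (G.res (fun y => u y * G.cutoff x r y) e t) ^ 2) := by
    have hpot : ∀ e t, lam / 2 ≤ lam - rho * |G.res u e t| ^ (p - 2) := fun e t => by
      have h0 := hu.res_pos e t
      have : |G.res u e t| ^ (p - 2) ≤ M ^ (p - 2) := by
        rw [abs_of_pos h0]
        exact Real.rpow_le_rpow h0.le (hle _) (by linarith)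
      nlinarith
    refine le_sum_integral (e := e) (a := 0) (fun e t => ?_) (fun e => hφ.integrable_form hG e
      (hu.continuous_potential hp lam rho e) (hu.abs_rpow_le hp hU lam rho e)) hb0.le hsub
      fun t ht => ?_
    · have := hpot e t
      have : 0 ≤ lam - rho * |G.res u e t| ^ (p - 2) := by linarith
      positivity
    · have hd : G.dist (G.pt e t) x ≤ r := by
        refine (dist_pt_pt_le e t 0).trans ?_
        rw [sub_zero, abs_of_nonneg ht.1]
        have : 0 ≤ Fintype.card E * (16 * U ^ 2) / (lam / 2 * (b * m ^ 2)) := by positivity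
        linarith [ht.2]
      have e1 : G.res (fun y => u y * G.cutoff x r y) e t = G.res u e t := by
        simp only [res]
        rw [cutoff_eq_one hr hd, mul_one]
      rw [e1]
      have h4 := hpot e t
      have h5 := hum t ht
      calc lam / 2 * m ^ 2 ≤ (lam - rho * |G.res u e t| ^ (p - 2)) * G.res u e t ^ 2 := by
            have h6 : 0 ≤ lam - rho * |G.res u e t| ^ (p - 2) := by linarith
            gcongr
        _ ≤ _ := by linarith [sq_nonneg (deriv (G.res (fun y => u y * G.cutoff x r y) e) t)]
  have h4 := h3.trans h2
  rw [← mul_div_assoc, le_div_iff₀ hr] at h4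
  have h5 : Fintype.card E * (16 * U ^ 2) / (lam / 2 * (b * m ^ 2)) < r := by
    rw [hr_def]; linarith
  rw [div_lt_iff₀ (by positivity)] at h5
  linarith

end Morse

/-! ### Counting the concentration points, and exponential decay. -/

section Concentration

variable {G : MetricGraph V E}

/-- The segment goes to the right of `t` if there is room, and otherwise to the left; a length of at
least `2 * d` ensures that one of them fits. -/
theorem exists_segment {e : E} {t d : ℝ} (ht : t ∈ G.I e) (hd : 0 ≤ d)
    (hlen : G.len e ≠ ⊤ → 2 * d ≤ (G.len e).toReal) :
    ∃ a, Set.Icc a (a + d) ⊆ G.I e ∧ ∀ s ∈ Set.Icc a (a + d), |s - t| ≤ d := by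
  have ht0 : 0 ≤ t := ht.1
  by_cases h : t + d ∈ G.I e
  · exact ⟨t, Icc_subset_I ht h, fun s hs => abs_le.2 ⟨by linarith [hs.1], by linarith [hs.2]⟩⟩
  · by_cases hl : G.len e = ⊤
    · rw [I_of_eq_top hl] at h
      exact absurd (add_nonneg ht0 hd) h
    · have h2 := hlen hl
      have ht' := ht
      rw [I_of_ne_top hl] at h ht'
      have h3 : (G.len e).toReal < t + d := by
        by_contra! hle
        exact h ⟨by linarith, hle⟩
      have h4 : t - d ∈ G.I e := by
        rw [I_of_ne_top hl]; constructor <;> linarith [ht'.2]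
      refine ⟨t - d, ?_, fun s hs => abs_le.2 ⟨by linarith [hs.1], by linarith [hs.2]⟩⟩
      rw [sub_add_cancel]
      exact Icc_subset_I h4 ht

/-- A maximal separated family of points. -/
theorem exists_maximal_separated {S : Set G.Point} {r : ℝ} (hr : 0 < r) (k : ℕ)
    (hS : S.Nonempty)
    (hk : ∀ T : Finset G.Point, (∀ x ∈ T, x ∈ S) →
      (∀ x ∈ T, ∀ y ∈ T, x ≠ y → r < G.dist x y) → T.card ≤ k) :
    ∃ x : Fin k → G.Point, (∀ j, x j ∈ S) ∧ ∀ y ∈ S, ∃ j, G.dist y (x j) ≤ r := by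
  classical
  let P : ℕ → Prop := fun n => ∃ T : Finset G.Point, (∀ x ∈ T, x ∈ S) ∧
    (∀ x ∈ T, ∀ y ∈ T, x ≠ y → r < G.dist x y) ∧ T.card = n
  obtain ⟨T, hT1, hT2, hT3⟩ : P (Nat.findGreatest P k) :=
    Nat.findGreatest_spec (Nat.zero_le k) ⟨∅, by simp, by simp, rfl⟩
  have hcover : ∀ y ∈ S, ∃ x ∈ T, G.dist y x ≤ r := by
    by_contra! hcon
    obtain ⟨y, hy, hfar⟩ := hcon
    have hyT : y ∉ T := fun h => by
      have := hfar y h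
      rw [dist_self] at this
      linarith
    have h1 : ∀ x ∈ insert y T, x ∈ S := by
      intro x hx
      rcases Finset.mem_insert.1 hx with rfl | hx
      exacts [hy, hT1 x hx]
    have h2 : ∀ x ∈ insert y T, ∀ z ∈ insert y T, x ≠ z → r < G.dist x z := by
      intro x hx z hz hne
      rcases Finset.mem_insert.1 hx with hxy | hx <;> rcases Finset.mem_insert.1 hz with hzy | hz
      · exact absurd (hxy.trans hzy.symm) hne
      · rw [hxy]; exact hfar z hz
      · rw [dist_comm, hzy]; exact hfar x hx
      · exact hT2 x hx z hz hne
    have h3 := hk _ h1 h2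
    have h4 := Nat.le_findGreatest (P := P) h3 ⟨_, h1, h2, rfl⟩
    rw [Finset.card_insert_of_notMem hyT, hT3] at h4
    omega
  obtain ⟨y₀, hy₀⟩ := hS
  obtain ⟨x₀, hx₀, -⟩ := hcover y₀ hy₀
  have : Nonempty T := ⟨⟨x₀, hx₀⟩⟩
  obtain ⟨f⟩ : Nonempty (T ↪ Fin k) := Function.Embedding.nonempty_of_card_le (by
    simpa using hk T hT1 hT2)
  -- `T` may have fewer than `k` points; the left inverse of the embedding then repeats some of
  -- them.
  refine ⟨fun j => (Function.invFun f j : T), fun j => hT1 _ (Function.invFun f j).2,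
    fun y hy => ?_⟩
  obtain ⟨x, hx, hd⟩ := hcover y hy
  obtain ⟨j, hj⟩ := Function.invFun_surjective f.injective ⟨x, hx⟩
  exact ⟨j, by simpa [hj] using hd⟩

variable [Fintype E] {p lam rho : ℝ} {u : G.Point → ℝ}

/-- Exponential decay in terms of the distance from the vertices and from the points where `u` is
not small. -/
theorem exists_le_exp_of_lt (hp : 2 < p) (hlam : 0 < lam) (hrho : rho ≤ 2)
    (hu : G.IsPositiveSolution p lam rho u) {M : ℝ}
    (hM' : M ^ (p - 2) = lam / 4) {e : E} {t : ℝ} (ht : t ∈ G.I e) (htM : G.res u e t < M) :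
    ∃ z ∈ G.I e, (z = 0 ∨ (G.len e ≠ ⊤ ∧ z = (G.len e).toReal) ∨ M ≤ G.res u e z) ∧
      G.res u e t ≤ 2 * M * Real.exp (-(√lam / 2) * |t - z|) := by
  -- If `r` is the distance from `t` to `Z`, then `[t - r, t + r]` stays in the edge and `u ≤ M` on
  -- it. There `rho * u ^ (p - 2) ≤ 2 * (lam / 4)`, hence `u'' ≥ (lam / 4) * u`.
  let Z : Set ℝ := {z | z ∈ G.I e ∧ (z = 0 ∨ (G.len e ≠ ⊤ ∧ z = (G.len e).toReal) ∨
    M ≤ G.res u e z)}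
  have hZc : IsClosed Z := by
    refine (isClosed_I e).inter ((isClosed_singleton (x := (0 : ℝ))).union (IsClosed.union ?_
      (isClosed_le continuous_const (hu.continuous_res e))))
    have : IsClosed {z : ℝ | G.len e ≠ ⊤ ∧ z = (G.len e).toReal} :=
      if h : G.len e = ⊤ then by simp [h] else by
        simp [h]
    exact this
  have h0Z : (0 : ℝ) ∈ Z := ⟨zero_mem_I e, .inl rfl⟩
  obtain ⟨z, hzZ, hz⟩ := hZc.exists_infDist_eq_dist ⟨0, h0Z⟩ t
  refine ⟨z, hzZ.1, hzZ.2, ?_⟩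
  set r := |t - z| with hr
  rw [Real.dist_eq, ← hr] at hz
  have hr0 : 0 ≤ r := abs_nonneg _
  have hle : ∀ w ∈ Z, r ≤ |t - w| := fun w hw => by
    rw [← hz, ← Real.dist_eq]; exact Metric.infDist_le_dist_of_mem hw
  have hsub : Set.Icc (t - r) (t + r) ⊆ G.I e := by
    have h1 := hle 0 h0Z
    rw [sub_zero, abs_of_nonneg ht.1] at h1
    by_cases h : G.len e = ⊤
    · rw [I_of_eq_top h]; intro s hs
      exact (sub_nonneg.2 h1).trans hs.1
    · have h2 := hle _ ⟨toReal_len_mem_I h, .inr (.inl ⟨h, rfl⟩)⟩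
      rw [I_of_ne_top h] at ht ⊢
      rw [abs_sub_comm, abs_of_nonneg (sub_nonneg.2 ht.2)] at h2
      intro s hs
      constructor <;> linarith [hs.1, hs.2]
  have hsmall : ∀ s ∈ Set.Icc (t - r) (t + r), G.res u e s ≤ M := by
    rcases hr0.eq_or_lt with h | h
    · intro s hs
      rw [← h] at hs
      have : s = t := by linarith [hs.1, hs.2]
      rw [this]; exact htM.le
    · have hcl : IsClosed {s | G.res u e s ≤ M} :=
        isClosed_le (hu.continuous_res e) continuous_const
      have hIoo : Set.Ioo (t - r) (t + r) ⊆ {s | G.res u e s ≤ M} := by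
        intro s hs
        by_contra hcon
        have := hle s ⟨hsub (Set.Ioo_subset_Icc_self hs), .inr (.inr (not_le.1 hcon).le)⟩
        have h2 : |t - s| < r := abs_lt.2 ⟨by linarith [hs.2], by linarith [hs.1]⟩
        linarith
      have := closure_minimal hIoo hcl
      rw [closure_Ioo (by linarith)] at this
      exact this
  have hs2 : √lam ^ 2 = lam := Real.sq_sqrt hlam.le
  have key := mul_cosh_le (k := √lam / 2) hr0
    (fun s hs => (hu.hasDerivWithinAt (hsub hs)).mono hsub)
    (fun s hs => (hu.hasDerivWithinAt_dres (hsub hs)).mono hsub) fun s hs => by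
      have h0 := hu.res_pos e s
      have h1 : G.res u e s ^ (p - 2) ≤ M ^ (p - 2) :=
        Real.rpow_le_rpow h0.le (hsmall s hs) (by linarith)
      have h3 := Real.rpow_nonneg h0.le (p - 2)
      rw [pow_split h0, div_pow, hs2]
      have h4 : rho * G.res u e s ^ (p - 2) ≤ lam / 2 := by nlinarith
      nlinarith
  have h1 := hsmall (t + r) ⟨by linarith, le_rfl⟩
  have h2 := hsmall (t - r) ⟨le_rfl, by linarith⟩
  have h3 : Real.exp (√lam / 2 * r) / 2 ≤ Real.cosh (√lam / 2 * r) := by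
    rw [Real.cosh_eq]
    have := Real.exp_pos (-(√lam / 2 * r))
    linarith
  have h4 : G.res u e t * Real.exp (√lam / 2 * r) ≤ 2 * M := by
    have := mul_le_mul_of_nonneg_left h3 (hu.res_pos e t).le
    linarith
  rw [neg_mul, Real.exp_neg, ← div_eq_mul_inv, le_div_iff₀ (Real.exp_pos _)]
  exact h4

/-- If the points where `u` is not small lie near finitely many points, then `u` decays
exponentially away from these points and from the vertices. -/
theorem le_sum_exp_of_cover [Fintype V] [Nonempty E] (hG : G.IsConnected) (hp : 2 < p)
    (hlam : 0 < lam) (hrho : rho ≤ 2) (hu : G.IsPositiveSolution p lam rho u) {M U B D : ℝ}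
    (hM0 : 0 < M) (hM' : M ^ (p - 2) = lam / 4) (huU : ∀ x, u x ≤ U) (hUB : U ≤ B)
    (hMB : 2 * M ≤ B) (hD : 0 ≤ D) {ι : Type*} [Fintype ι] {x : ι → G.Point}
    (hx2 : ∀ y, M ≤ u y → ∃ j, G.dist y (x j) ≤ D / √lam) (y : G.Point) :
    u y ≤ B * Real.exp (D / 2) * ∑ j, Real.exp (-(√lam / 2) * G.dist y (x j)) +
      B * Real.exp (D / 2) * ∑ v : V, Real.exp (-(√lam / 2) * G.dist y (.vertex v)) := by
  set s := √lam
  have hs0 : 0 < s := Real.sqrt_pos.2 hlam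
  have hB0 : 0 < B := lt_of_lt_of_le (by linarith) hMB
  -- Passing from `z` to a centre costs the factor `exp (D / 2)`, since `s / 2 * (D / s) = D / 2`.
  -- It serves both for `z = y`, when `u y` is not small, and for the point given by
  -- `exists_le_exp_of_lt`.
  have hnear : ∀ {z : G.Point} {N a : ℝ}, 0 ≤ N → N ≤ B → G.dist y z ≤ a →
      u y ≤ N * Real.exp (-(s / 2) * a) → M ≤ u z →
      ∃ j, u y ≤ B * Real.exp (D / 2) *
        Real.exp (-(s / 2) * G.dist y (x j)) := by
    intro z N a hN0 hN ha hy hz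
    obtain ⟨j, hj⟩ := hx2 z hz
    refine ⟨j, hy.trans ?_⟩
    have h1 := dist_triangle hG y z (x j)
    have h2 : -(s / 2) * a ≤ D / 2 + -(s / 2) * G.dist y (x j) := by
      have h3 : s / 2 * G.dist y (x j) ≤ s / 2 * (a + D / s) := by
        have : G.dist y (x j) ≤ a + D / s := by linarith
        gcongr
      have h4 : s / 2 * (a + D / s) = s / 2 * a + D / 2 := by field_simp
      linarith
    calc N * Real.exp (-(s / 2) * a)
        ≤ B * Real.exp (D / 2 + -(s / 2) * G.dist y (x j)) := by gcongr
      _ = _ := by rw [Real.exp_add]; ring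
  have hcase : (∃ j, u y ≤ B * Real.exp (D / 2) *
        Real.exp (-(s / 2) * G.dist y (x j))) ∨
      ∃ v, u y ≤ B * Real.exp (D / 2) *
        Real.exp (-(s / 2) * G.dist y (.vertex v)) := by
    rcases le_or_gt M (u y) with hyM | hyM
    · left
      refine hnear (z := y) (N := U) (a := 0) ((hu.pos y).le.trans (huU y)) hUB (dist_self y).le ?_ hyM
      simpa using huU y
    · obtain ⟨e, t, ht, rfl⟩ := exists_pt_eq hG y
      obtain ⟨z, hzI, hz, hle⟩ := exists_le_exp_of_lt hp hlam hrho hu hM' ht hyM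
      have hdz := dist_pt_pt_le (G := G) e t z
      have hvert : ∀ v, G.pt e z = .vertex v → u (G.pt e t) ≤ B * Real.exp (D / 2) *
          Real.exp (-(s / 2) * G.dist (G.pt e t) (.vertex v)) := by
        intro v hv
        rw [← hv]
        refine hle.trans ?_
        have h1 : Real.exp (-(s / 2) * |t - z|) ≤
            Real.exp (-(s / 2) * G.dist (G.pt e t) (G.pt e z)) := by
          refine Real.exp_le_exp.2 ?_
          nlinarith
        have h2 : (2 * M) ≤ B * Real.exp (D / 2) := by
          have h3 : 1 ≤ Real.exp (D / 2) := Real.one_le_exp (by linarith)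
          nlinarith
        gcongr
      rcases hz with rfl | ⟨hl, rfl⟩ | hz
      · exact .inr ⟨_, hvert _ (pt_zero e)⟩
      · exact .inr ⟨_, hvert _ (pt_toReal_len hl)⟩
      · left
        exact hnear (z := G.pt e z) (N := 2 * M) (a := |t - z|) (by positivity) hMB hdz hle hz
  have hsum1 : 0 ≤ ∑ j, Real.exp (-(s / 2) * G.dist y (x j)) := by positivity
  have hsum2 : 0 ≤ ∑ v : V, Real.exp (-(s / 2) * G.dist y (.vertex v)) := by positivity
  have hC0 : 0 ≤ B * Real.exp (D / 2) := by positivity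
  rcases hcase with ⟨j, hj⟩ | ⟨v, hv⟩
  · refine (hj.trans (mul_le_mul_of_nonneg_left ?_ hC0)).trans
      (le_add_of_nonneg_right (mul_nonneg hC0 hsum2))
    exact Finset.single_le_sum (f := fun j => Real.exp (-(s / 2) * G.dist y (x j)))
      (fun _ _ => (Real.exp_pos _).le) (Finset.mem_univ j)
  · refine (hv.trans (mul_le_mul_of_nonneg_left ?_ hC0)).trans
      (le_add_of_nonneg_left (mul_nonneg hC0 hsum1))
    exact Finset.single_le_sum (f := fun v => Real.exp (-(s / 2) * G.dist y (.vertex v)))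
      (fun _ _ => (Real.exp_pos _).le) (Finset.mem_univ v)

/-- The functions `u * cutoff` live in closed balls of radius `2 * r`, which are disjoint when the
centres are more than `4 * r` apart. -/
theorem card_separated_le [Fintype V] [Nonempty E] (hG : G.IsConnected) (hp : 2 < p)
    (hu : G.IsPositiveSolution p lam rho u) {U : ℝ} (huU : ∀ x, u x ≤ U)
    (hlip : ∀ e, ∃ K, LipschitzWith K (G.res u e)) {k : ℕ}
    (hmorse : G.morseIndex p lam rho u ≤ k) {r : ℝ} (hr0 : 0 < r) {T : Finset G.Point}
    (hT1 : ∀ x ∈ T, G.Q p lam rho u (fun y => u y * G.cutoff x r y) < 0)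
    (hT2 : ∀ x ∈ T, ∀ y ∈ T, x ≠ y → 4 * r < G.dist x y) : T.card ≤ k := by
  have hφ : ∀ x, G.IsTest fun y => u y * G.cutoff x r y := fun x =>
    (isTest_cutoff hG x hr0).mul_of_bounded (abs_cutoff_le_one x r) hlip (U := U) fun x => by
      rw [abs_of_pos (hu.pos x)]; exact huU x
  have := card_le_morseIndex hG (ι := T) (φ := fun x y => u y * G.cutoff x r y)
    (fun x => hφ x) (Z := fun x => {y | G.dist y x ≤ 2 * r})
    (fun x => isClosed_closedBall hG x (2 * r))
    (fun x y hne => Set.disjoint_left.2 fun z (hz1 : G.dist z x ≤ 2 * r)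
      (hz2 : G.dist z y ≤ 2 * r) => by
        have h1 := hT2 x x.2 y y.2 fun h => hne (Subtype.ext h)
        have h2 := dist_triangle hG (x : G.Point) z y
        rw [dist_comm (x : G.Point) z] at h2
        linarith)
    (fun x y hy => dist_le_of_cutoff_ne_zero hr0 fun h => hy (by simp [h]))
    (hu.continuous_potential hp lam ((p - 1) * rho))
    (hu.abs_rpow_le hp huU lam ((p - 1) * rho))
    fun x => hT1 x x.2
  have h2 := this.trans hmorse
  simpa using h2

theorem eventually_long (G : MetricGraph V E) :
    ∀ᶠ lam : ℝ in atTop, 0 < lam ∧ ∀ e, G.len e ≠ ⊤ → 1 ≤ lam * (G.len e).toReal ^ 2 := by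
  refine (eventually_gt_atTop 0).and (eventually_all.2 fun e => ?_)
  by_cases h : G.len e = ⊤
  · simp [h]
  · have h1 : 0 < (G.len e).toReal ^ 2 := pow_pos (toReal_len_pos h) 2
    filter_upwards [eventually_ge_atTop (1 / (G.len e).toReal ^ 2)] with lam hl _
    rwa [div_le_iff₀ h1] at hl

/-- Near every point where `u` is not small there is a negative direction. -/
theorem Q_mul_cutoff_neg_of_le [Fintype V] [Nonempty E] (hG : G.IsConnected) (hp : 2 < p)
    (hrho : 1 / 2 ≤ rho) (hu : G.IsPositiveSolution p lam rho u) {A s β μ R : ℝ} (hA0 : 0 < A)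
    (hs0 : 0 < s) (hs2 : s ^ 2 = lam) (hA' : A ^ (p - 2) = lam) (hβ1 : 1 ≤ β) (hμ0 : 0 < μ)
    (hμ1 : μ ≤ 1) (hR1 : 1 ≤ R)
    (hR : Fintype.card E * (16 * β ^ 2) < (p - 2) / 2 * (μ / (14 * β)) * (μ / 2) ^ p * R)
    (hlong : ∀ e, G.len e ≠ ⊤ → 1 ≤ lam * (G.len e).toReal ^ 2)
    (huU : ∀ x, u x ≤ β * A)
    (hlip : ∀ e, LipschitzWith (7 * s * (β * A)).toNNReal (G.res u e)) {x : G.Point}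
    (hx : μ * A ≤ u x) : G.Q p lam rho u (fun y => u y * G.cutoff x (R / s) y) < 0 := by
  -- With Lipschitz constant `7 * s * (β * A)`, `u` loses at most `μ * A / 2` over the distance `d`.
  obtain ⟨d, hd⟩ : ∃ d, d = μ / (14 * β * s) := ⟨_, rfl⟩
  have hd0 : 0 < d := by rw [hd]; positivity
  have hds : 2 * d * s ≤ 1 := by
    have : 2 * d * s = μ / (7 * β) := by rw [hd]; field_simp; ring
    rw [this, div_le_one (by positivity)]
    linarith
  have hdr : d ≤ R / s := by
    rw [le_div_iff₀ hs0]; linarith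
  have hMA : 0 < μ * A := mul_pos hμ0 hA0
  obtain ⟨e, t, ht, rfl⟩ := exists_pt_eq hG x
  obtain ⟨a, ha1, ha2⟩ := exists_segment ht hd0.le fun h => by
    have h1 := hlong e h
    rw [← hs2, ← mul_pow] at h1
    have h2 : 1 ≤ s * (G.len e).toReal := by
      by_contra! hlt
      have : 0 < s * (G.len e).toReal := mul_pos hs0 (toReal_len_pos h)
      nlinarith
    by_contra! hlt
    nlinarith
  refine Q_mul_cutoff_neg hG hp (by linarith [hrho]) hu huU (fun e => ⟨_, hlip e⟩) (div_pos (by linarith) hs0) hd0.le ha1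
    (half_pos hMA) (fun w hw => ?_) (fun w hw => ?_) ?_
  · exact (dist_pt_pt_le e w t).trans ((ha2 w hw).trans hdr)
  · have h1 := (hlip e).dist_le_mul w t
    rw [Real.dist_eq, Real.dist_eq, Real.coe_toNNReal _ (by positivity)] at h1
    have h2 : 7 * s * (β * A) * |w - t| ≤ 7 * s * (β * A) * d := by
      have := ha2 w hw; gcongr
    have h3 : 7 * s * (β * A) * d = μ * A / 2 := by rw [hd]; field_simp; ring
    have h4 := (abs_le.1 (h1.trans h2)).1
    change μ * A ≤ G.res u e t at hx
    linarith
  · have e1 : (μ * A / 2) ^ p = (μ / 2) ^ p * (s ^ 2 * A ^ 2) := by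
      rw [mul_div_right_comm, Real.mul_rpow (by positivity) hA0.le, hs2]
      congr 1
      have : A ^ p = A ^ (p - 2) * A ^ 2 := by
        rw [← Real.rpow_add_natCast hA0.ne']; norm_num
      rw [this, hA']
    obtain ⟨κ, hκ⟩ : ∃ κ, κ = (p - 2) / 2 * (μ / (14 * β)) * (μ / 2) ^ p := ⟨_, rfl⟩
    -- Both sides scale like `s * A ^ 2`, so the condition on `R` does not involve `lam`.
    have e2 : Fintype.card E * (16 * (β * A) ^ 2 / (R / s)) =
        Fintype.card E * (16 * β ^ 2) / R * (s * A ^ 2) := by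
      field_simp
    have e3 : (p - 2) * rho * (d * (μ * A / 2) ^ p) = 2 * rho * κ * (s * A ^ 2) := by
      rw [e1, hd, hκ]; field_simp
    rw [e2, e3]
    rw [← hκ, ← div_lt_iff₀ (by linarith)] at hR
    have hκ0 : 0 < κ := lt_of_le_of_lt (by positivity) hR
    have h2 : κ ≤ 2 * rho * κ := by nlinarith
    exact mul_lt_mul_of_pos_right (hR.trans_le h2) (by positivity)

/-- For large `lam`, a solution of Morse index at most `k` concentrates near at most `k` points. -/
theorem exists_concentration [Fintype V] [Nonempty E] (hG : G.IsConnected) (hp : 2 < p) (k : ℕ) :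
    ∃ C > 0, ∃ μ > 0, ∃ D > 0, ∀ᶠ lam : ℝ in atTop, ∀ rho ∈ Set.Icc (1 / 2 : ℝ) 2,
      ∀ u : G.Point → ℝ, G.IsPositiveSolution p lam rho u → G.morseIndex p lam rho u ≤ k →
      ∃ x : Fin k → G.Point, (∀ j, μ * lam ^ (1 / (p - 2)) ≤ u (x j)) ∧
        (∀ y, μ * lam ^ (1 / (p - 2)) ≤ u y → ∃ j, G.dist y (x j) ≤ D / √lam) ∧
        ∀ y, u y ≤ C * lam ^ (1 / (p - 2)) *
            ∑ j, Real.exp (-(√lam / 2) * G.dist y (x j)) +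
          C * lam ^ (1 / (p - 2)) *
            ∑ v : V, Real.exp (-(√lam / 2) * G.dist y (.vertex v)) := by
  have hp2 : 0 < p - 2 := by linarith
  have hroot : ∀ a : ℝ, 0 < a → (a ^ (1 / (p - 2))) ^ (p - 2) = a := fun a ha => by
    rw [← Real.rpow_mul ha.le, one_div_mul_cancel hp2.ne', Real.rpow_one]
  -- These normalise the upper bound `U = β * A`, with `U ^ (p - 2) = 84 * p * lam`, and the decay
  -- threshold `M = μ * A`, with `M ^ (p - 2) = lam / 4`.
  set β : ℝ := (84 * p) ^ (1 / (p - 2)) with hβ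
  set μ : ℝ := (1 / 4 : ℝ) ^ (1 / (p - 2)) with hμ
  have hβ1 : 1 ≤ β := Real.one_le_rpow (by linarith) (by positivity)
  have hμ0 : 0 < μ := by positivity
  have hμ1 : μ ≤ 1 := Real.rpow_le_one (by norm_num) (by norm_num) (by positivity)
  obtain ⟨R, hR1, hRκ⟩ : ∃ R : ℝ, 1 ≤ R ∧ Fintype.card E * (16 * β ^ 2) <
      (p - 2) / 2 * (μ / (14 * β)) * (μ / 2) ^ p * R := by
    have hκ0 : 0 < (p - 2) / 2 * (μ / (14 * β)) * (μ / 2) ^ p := by positivity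
    obtain ⟨R, hR⟩ := exists_gt (max 1 (Fintype.card E * (16 * β ^ 2) /
      ((p - 2) / 2 * (μ / (14 * β)) * (μ / 2) ^ p)))
    exact ⟨R, ((le_max_left _ _).trans_lt hR).le,
      (div_lt_iff₀' hκ0).1 ((le_max_right _ _).trans_lt hR)⟩
  -- `β + 2 * μ` dominates both the upper bound and twice the threshold; `4 * R / √lam` is the
  -- separation of the centres, and `exp (2 * R)` is the factor `exp (D / 2)`.
  refine ⟨(β + 2 * μ) * Real.exp (2 * R), by positivity, μ, hμ0, 4 * R, by positivity, ?_⟩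
  filter_upwards [G.eventually_long] with lam hlam rho hrho u hu hmorse
  obtain ⟨hlam, hlong⟩ := hlam
  set A := lam ^ (1 / (p - 2)) with hA
  have hA0 : 0 < A := by positivity
  have hA' : A ^ (p - 2) = lam := hroot lam hlam
  set s := √lam with hs
  have hs0 : 0 < s := Real.sqrt_pos.2 hlam
  have hs2 : s ^ 2 = lam := Real.sq_sqrt hlam.le
  set U := β * A with hU
  have hU0 : 0 < U := by positivity
  have hU' : U ^ (p - 2) = 84 * p * lam := by
    rw [hU, Real.mul_rpow (by positivity) hA0.le, hA', hβ, hroot _ (by positivity)]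
  set M := μ * A with hM
  have hM0 : 0 < M := by positivity
  have hM' : M ^ (p - 2) = lam / 4 := by
    rw [hM, Real.mul_rpow hμ0.le hA0.le, hA', hμ, hroot _ (by positivity)]; ring
  have hbd := fun {e : E} {t : ℝ} (ht : t ∈ G.I e) =>
    hu.bounds hp hlam hrho.1 hlong hU0 hU' ht
  have huU : ∀ x, u x ≤ U := fun x => by
    obtain ⟨e, t, ht, rfl⟩ := exists_pt_eq hG x
    exact (hbd ht).1
  have hlip : ∀ e, LipschitzWith (7 * s * U).toNNReal (G.res u e) := fun e =>
    lipschitzWith_res_of_abs_dres_le hu fun t ht => by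
      rw [Real.coe_toNNReal _ (by positivity)]
      refine abs_le_of_sq_le_sq ?_ (by positivity)
      have := (hbd ht).2
      rw [← hs2] at this
      -- The constant `7` comes from `43 ≤ 7 ^ 2`.
      nlinarith [sq_nonneg (s * U)]
  have hlip' : ∀ e, ∃ K, LipschitzWith K (G.res u e) := fun e => ⟨_, hlip e⟩
  set r := R / s with hr
  have hr0 : 0 < r := by positivity
  have hneg : ∀ x, M ≤ u x → G.Q p lam rho u (fun y => u y * G.cutoff x r y) < 0 :=
    fun x hx => Q_mul_cutoff_neg_of_le hG hp hrho.1 hu hA0 hs0 hs2 hA' hβ1 hμ0 hμ1 hR1 hRκ hlong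
      huU hlip hx
  obtain ⟨x₀, hx₀⟩ := exists_lt_of_isPositiveSolution hG hp hlam (by linarith [hrho.1]) hu huU
    hlip' (M := M) (by rw [hM']; nlinarith [hrho.2])
  obtain ⟨x, hx1, hx2⟩ := exists_maximal_separated (S := {y | M ≤ u y}) (r := 4 * r)
    (by positivity) k ⟨x₀, hx₀.le⟩ fun T hT1 hT2 =>
      card_separated_le hG hp hu huU hlip' hmorse hr0 (fun x hx => hneg x (hT1 x hx)) hT2
  have h4r : 4 * r = 4 * R / s := by rw [hr]; ring
  rw [h4r] at hx2
  refine ⟨x, hx1, hx2, fun y => ?_⟩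
  have := le_sum_exp_of_cover hG hp hlam hrho.2 hu hM0 hM' huU (B := (β + 2 * μ) * A)
    (by rw [hU]; gcongr; linarith) (by rw [hM, ← mul_assoc]; gcongr; linarith) (by positivity)
    hx2 y
  have e : 4 * R / 2 = 2 * R := by ring
  rw [e, mul_right_comm (β + 2 * μ)] at this
  exact this

end Concentration

/-! ### Subsequences and clusters. -/

section Sequences

/-- Compactness of `[0, ∞] ^ ι`: each coordinate of a limit is infinite or finite. -/
theorem exists_subseq_tendsto_atTop_or_bounded {ι : Type*} [Finite ι] (d : ℕ → ι → ℝ) :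
    ∃ φ : ℕ → ℕ, StrictMono φ ∧
      ∀ i, Tendsto (fun n => d (φ n) i) atTop atTop ∨ ∃ M, ∀ n, d (φ n) i ≤ M := by
  obtain ⟨a, φ, hφ, ha⟩ := CompactSpace.tendsto_subseq (X := ι → ℝ≥0∞)
    fun n i => ENNReal.ofReal (d n i)
  refine ⟨φ, hφ, fun i => ?_⟩
  have hi : Tendsto (fun n => ENNReal.ofReal (d (φ n) i)) atTop (𝓝 (a i)) :=
    tendsto_pi_nhds.1 ha i
  by_cases h : a i = ⊤
  · left
    rw [h] at hi
    exact ENNReal.tendsto_ofReal_nhds_top.1 hi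
  · right
    obtain ⟨M, hM⟩ := ((ENNReal.tendsto_toReal h).comp hi).bddAbove_range
    refine ⟨M, fun n => ?_⟩
    have h1 := hM ⟨n, rfl⟩
    simp only [Function.comp, ENNReal.toReal_ofReal'] at h1
    exact (le_max_left _ _).trans h1

theorem exists_tendsto_atTop_le {ι : Type*} [Finite ι] {f : ι → ℕ → ℝ}
    (hf : ∀ i, Tendsto (f i) atTop atTop) :
    ∃ r : ℕ → ℝ, Tendsto r atTop atTop ∧ ∀ n i, r n ≤ f i n := by
  have := Fintype.ofFinite ι
  -- The additional entry `n` keeps the minimum defined and divergent when `ι` is empty, as happens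
  -- with a single cluster.
  let g : ℕ → Option ι → ℝ := fun n o => o.elim (n : ℝ) fun i => f i n
  refine ⟨fun n => Finset.univ.inf' Finset.univ_nonempty (g n), ?_, fun n i => ?_⟩
  · refine tendsto_atTop.2 fun b => ?_
    have h : ∀ o : Option ι, ∀ᶠ n in atTop, b ≤ g n o := by
      rintro (_ | i)
      · exact tendsto_atTop.1 tendsto_natCast_atTop_atTop b
      · exact tendsto_atTop.1 (hf i) b
    filter_upwards [eventually_all.2 h] with n hn
    exact Finset.le_inf' _ _ fun o _ => hn o
  · exact Finset.inf'_le (g n) (Finset.mem_univ (some i))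

variable {G : MetricGraph V E}

/-- A finite cover of the sets where the functions are not small can be grouped, along a
subsequence, into clusters which drift apart from each other. -/
theorem exists_clusters [Finite E] [Nonempty E] (hG : G.IsConnected) {ι : Type*} [Fintype ι]
    [Nonempty ι] {L : ℕ → ℝ} (hL : ∀ n, 0 < L n) {u : ℕ → G.Point → ℝ}
    (hu : ∀ n, Continuous (u n)) {x : ℕ → ι → G.Point} {m : ℕ → ℝ}
    (hx : ∀ n j, m n ≤ u n (x n j)) {D : ℝ} (hD : 0 ≤ D)
    (hcov : ∀ n y, m n ≤ u n y → ∃ j, G.dist y (x n j) ≤ D / L n) :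
    ∃ φ : ℕ → ℕ, StrictMono φ ∧ ∃ k : ℕ, 1 ≤ k ∧ k ≤ Fintype.card ι ∧
      ∃ P : Fin k → ℕ → G.Point,
        (∀ i j, i ≠ j →
          Tendsto (fun n => L (φ n) * G.dist (P i n) (P j n)) atTop atTop) ∧
        (∃ r : ℕ → ℝ, (∀ n, 0 < r n) ∧ Tendsto r atTop atTop ∧
          ∀ n i, IsMaxOn (u (φ n)) (G.ball (P i n) (r n / L (φ n))) (P i n)) ∧
        ∃ M, ∀ n j, ∃ i, L (φ n) * G.dist (x (φ n) j) (P i n) ≤ M := by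
  classical
  obtain ⟨φ, hφ, hdich⟩ := exists_subseq_tendsto_atTop_or_bounded
    fun n (ij : ι × ι) => L n * G.dist (x n ij.1) (x n ij.2)
  have htri : ∀ n (a b c : G.Point),
      L n * G.dist a c ≤ L n * G.dist a b + L n * G.dist b c := fun n a b c => by
    rw [← mul_add]
    exact mul_le_mul_of_nonneg_left (dist_triangle hG a b c) (hL n).le
  -- Bounded rescaled distance is an equivalence relation; by the dichotomy, inequivalent centres
  -- drift apart.
  let S : Setoid ι :=
    { r := fun i j => ∃ M, ∀ n, L (φ n) * G.dist (x (φ n) i) (x (φ n) j) ≤ M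
      iseqv :=
        { refl := fun i => ⟨0, fun n => by simp [dist_self]⟩
          symm := fun ⟨M, hM⟩ => ⟨M, fun n => by rw [dist_comm]; exact hM n⟩
          trans := fun ⟨M, hM⟩ ⟨N, hN⟩ => ⟨M + N, fun n =>
            (htri _ _ _ _).trans (add_le_add (hM n) (hN n))⟩ } }
  have hrel : ∀ i j, (⟦i⟧ : Quotient S) = ⟦j⟧ ↔
      ∃ M, ∀ n, L (φ n) * G.dist (x (φ n) i) (x (φ n) j) ≤ M := fun i j => Quotient.eq
  obtain ⟨M, hM⟩ : ∃ M, ∀ i j, (⟦i⟧ : Quotient S) = ⟦j⟧ → ∀ n,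
      L (φ n) * G.dist (x (φ n) i) (x (φ n) j) ≤ M := by
    have : ∀ ij : ι × ι, ∃ M, (⟦ij.1⟧ : Quotient S) = ⟦ij.2⟧ → ∀ n,
        L (φ n) * G.dist (x (φ n) ij.1) (x (φ n) ij.2) ≤ M := fun ij => by
      by_cases h : (⟦ij.1⟧ : Quotient S) = ⟦ij.2⟧
      · obtain ⟨M, hM⟩ := (hrel _ _).1 h
        exact ⟨M, fun _ => hM⟩
      · exact ⟨0, fun h' => absurd h' h⟩
    choose N hN using this
    obtain ⟨M, hM⟩ := (Set.finite_range N).bddAbove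
    exact ⟨M, fun i j h n => (hN (i, j) h n).trans (hM ⟨(i, j), rfl⟩)⟩
  let C : ℕ → Quotient S → Set G.Point := fun n q =>
    ⋃ i : {i : ι // (⟦i⟧ : Quotient S) = q}, {y | G.dist y (x (φ n) i) ≤ D / L (φ n)}
  have hxC : ∀ n i, x (φ n) i ∈ C n ⟦i⟧ := fun n i => Set.mem_iUnion.2 ⟨⟨i, rfl⟩, by
    rw [Set.mem_ofPred_eq, dist_self]; exact div_nonneg hD (hL _).le⟩
  have hmax : ∀ n q, ∃ y ∈ C n q, IsMaxOn (u (φ n)) (C n q) y := fun n q => by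
    obtain ⟨i, rfl⟩ := Quotient.exists_rep q
    exact (isCompact_iUnion fun i => isCompact_closedBall hG _ _).exists_isMaxOn ⟨_, hxC n i⟩
      (hu _).continuousOn
  choose P hPC hPmax using hmax
  have hPx : ∀ n i, L (φ n) * G.dist (x (φ n) i) (P n ⟦i⟧) ≤ M + D := fun n i => by
    obtain ⟨⟨j, hj⟩, hd⟩ := Set.mem_iUnion.1 (hPC n ⟦i⟧)
    rw [Set.mem_ofPred_eq, dist_comm, le_div_iff₀' (hL _)] at hd
    exact (htri _ _ (x (φ n) j) _).trans (add_le_add (hM i j hj.symm n) hd)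
  have hsep : ∀ q q', q ≠ q' →
      Tendsto (fun n => L (φ n) * G.dist (P n q) (P n q')) atTop atTop := by
    intro q q' hne
    obtain ⟨i, rfl⟩ := Quotient.exists_rep q
    obtain ⟨j, rfl⟩ := Quotient.exists_rep q'
    have h1 : Tendsto (fun n => L (φ n) * G.dist (x (φ n) i) (x (φ n) j)) atTop atTop :=
      (hdich (i, j)).resolve_right fun h => hne ((hrel i j).2 h)
    refine tendsto_atTop_mono (fun n => ?_)
      (tendsto_atTop_add_const_right _ (-(2 * (M + D))) h1)
    have h2 := htri (φ n) (x (φ n) i) (P n ⟦i⟧) (x (φ n) j)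
    have h3 := htri (φ n) (P n ⟦i⟧) (P n ⟦j⟧) (x (φ n) j)
    have h4 := hPx n j
    rw [dist_comm] at h4
    linarith [hPx n i]
  -- Why `M + D + D`: a point of the ball within `D / L` of a centre of another cluster would put
  -- the two maximum points at rescaled distance below `r + D + (M + D)`.
  obtain ⟨r, hr, hrle⟩ := exists_tendsto_atTop_le
    (ι := {qq : Quotient S × Quotient S // qq.1 ≠ qq.2})
    (f := fun qq n => L (φ n) * G.dist (P n qq.1.1) (P n qq.1.2) + -(M + D + D))
    fun qq => tendsto_atTop_add_const_right _ _ (hsep _ _ qq.2)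
  -- A point of the ball with `u ≥ m` must lie in the set `C n q` over which the maximum was taken;
  -- at the other points `u ≤ m ≤ u (P n q)`.
  have hball : ∀ n q, IsMaxOn (u (φ n)) (G.ball (P n q) (r n / L (φ n))) (P n q) := by
    intro n q y (hy : G.dist y (P n q) < r n / L (φ n))
    change u (φ n) y ≤ u (φ n) (P n q)
    have hPm : m (φ n) ≤ u (φ n) (P n q) := by
      obtain ⟨i, rfl⟩ := Quotient.exists_rep q
      exact (hx _ i).trans (hPmax n _ (hxC n i))
    rcases le_total (m (φ n)) (u (φ n) y) with h | h
    · obtain ⟨j, hj⟩ := hcov _ y h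
      by_cases hq : (⟦j⟧ : Quotient S) = q
      · exact hPmax n q (Set.mem_iUnion.2 ⟨⟨j, hq⟩, hj⟩)
      · exfalso
        have h1 := hrle n ⟨(q, ⟦j⟧), fun h => hq h.symm⟩
        simp only at h1
        rw [lt_div_iff₀' (hL _), dist_comm] at hy
        rw [le_div_iff₀' (hL _)] at hj
        have h2 := htri (φ n) (P n q) y (P n ⟦j⟧)
        have h3 := htri (φ n) y (x (φ n) j) (P n ⟦j⟧)
        linarith [hPx n j]
    · exact h.trans hPm
  -- The sequence is shifted so that the radii are positive for every `n`.
  obtain ⟨N, hN⟩ := eventually_atTop.1 (hr.eventually_gt_atTop 0)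
  let e := Fintype.equivFin (Quotient S)
  have hshift : Tendsto (fun n => n + N) atTop atTop := tendsto_add_atTop_nat N
  refine ⟨fun n => φ (n + N), fun a b h => hφ (by omega), Fintype.card (Quotient S),
    Fintype.card_pos_iff.2 ⟨⟦Classical.arbitrary ι⟧⟩, Fintype.card_quotient_le S, fun i n => P (n + N) (e.symm i),
    fun i j hne => ?_, ⟨fun n => r (n + N), fun n => hN _ (by omega), hr.comp hshift,
      fun n i => hball _ _⟩, M + D, fun n j => ⟨e ⟦j⟧, ?_⟩⟩
  · exact (hsep _ _ fun h => hne (e.symm.injective h)).comp hshift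
  · simpa using hPx (n + N) j

end Sequences

end MetricGraph

/-! ### Assembly along the sequence. -/

theorem theorem4p5 {V E : Type*} [Fintype V] [Fintype E] [Nonempty E]
    (G : MetricGraph V E) (hG : G.IsConnected)
    (p : ℝ) (hp : 6 < p)
    (lam rho : ℕ → ℝ) (hlam : Tendsto lam atTop atTop) (hrho : Tendsto rho atTop (𝓝 1))
    (u : ℕ → G.Point → ℝ) (hu : ∀ n, G.IsPositiveSolution p (lam n) (rho n) (u n))
    (kbar : ℕ) (hkbar : 1 ≤ kbar)
    (hm : ∀ n, G.morseIndex p (lam n) (rho n) (u n) ≤ (kbar : ℕ∞)) :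
    ∃ s : ℕ → ℕ, StrictMono s ∧ (∀ n, 0 < lam (s n)) ∧
    ∃ k : ℕ, 1 ≤ k ∧ k ≤ kbar ∧ ∃ P : Fin k → ℕ → G.Point,
      (∀ i j, i ≠ j →
        Tendsto (fun n => (lam (s n)) ^ (1 / 2 : ℝ) * G.dist (P i n) (P j n)) atTop atTop) ∧
      (∃ r : ℕ → ℝ, (∀ n, 0 < r n) ∧ Tendsto r atTop atTop ∧
        ∀ n i, IsMaxOn (u (s n)) (G.ball (P i n) (r n * (lam (s n)) ^ (-(1 / 2) : ℝ))) (P i n)) ∧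
      ∃ C₁ > 0, ∃ C₂ > 0, ∀ R > 0, ∀ n, ∀ x : G.Point,
        (∀ i, x ∉ G.ball (P i n) (R * (lam (s n)) ^ (-(1 / 2) : ℝ))) →
        u (s n) x ≤
          C₁ * (lam (s n)) ^ (1 / (p - 2)) *
            ∑ i, Real.exp (-C₂ * (lam (s n)) ^ (1 / 2 : ℝ) * G.dist x (P i n)) +
          C₁ * (lam (s n)) ^ (1 / (p - 2)) *
            ∑ v : V, Real.exp (-C₂ * (lam (s n)) ^ (1 / 2 : ℝ) * G.dist x (.vertex v)) := by
  obtain ⟨C, hC, μ, hμ, D, hD, hev⟩ := MetricGraph.exists_concentration hG (by linarith : 2 < p) kbar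
  have hrho' : ∀ᶠ n in atTop, rho n ∈ Set.Icc (1 / 2 : ℝ) 2 :=
    hrho.eventually (Icc_mem_nhds (by norm_num) (by norm_num))
  obtain ⟨N, hN⟩ := eventually_atTop.1
    ((hlam.eventually hev).and (hrho'.and (hlam.eventually_gt_atTop 0)))
  have hpos : ∀ n, 0 < lam (n + N) := fun n => (hN _ (by omega)).2.2
  choose x hx1 hx2 hx3 using fun n => (hN (n + N) (by omega)).1 (rho (n + N))
    (hN (n + N) (by omega)).2.1 (u (n + N)) (hu _) (hm _)
  have : Nonempty (Fin kbar) := ⟨⟨0, hkbar⟩⟩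
  obtain ⟨φ, hφ, k, hk1, hk2, P, hP1, ⟨r, hr0, hr, hP2⟩, M, hM⟩ := MetricGraph.exists_clusters hG
    (L := fun n => √(lam (n + N))) (fun n => Real.sqrt_pos.2 (hpos n))
    (fun n => (hu (n + N)).memH1.1) hx1 hD.le hx2
  have hneg : ∀ n, (lam (φ n + N)) ^ (-(1 / 2) : ℝ) = (√(lam (φ n + N)))⁻¹ := fun n => by
    rw [Real.rpow_neg (hpos _).le, Real.sqrt_eq_rpow]
  refine ⟨fun n => φ n + N, fun a b h => Nat.add_lt_add_right (hφ h) N, fun n => hpos _, k, hk1,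
    by simpa using hk2, P, ?_, ⟨r, hr0, hr, ?_⟩,
    -- Each of the `kbar` centres is within `M / √lam` of some `P i`, so replacing it costs a factor
    -- `exp (M / 2)`; the `1` serves the sum over the vertices.
    C * (kbar * Real.exp (M / 2) + 1), by positivity, 1 / 2, by norm_num, ?_⟩
  · simpa only [Real.sqrt_eq_rpow] using hP1
  · simpa only [hneg, ← div_eq_mul_inv] using hP2
  · intro R _ n y _
    refine (hx3 (φ n) y).trans ?_
    simp only [← Real.sqrt_eq_rpow]
    set s := √(lam (φ n + N)) with hs
    have hs0 : 0 < s := Real.sqrt_pos.2 (hpos _)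
    set A := lam (φ n + N) ^ (1 / (p - 2))
    have hA0 : 0 < A := Real.rpow_pos_of_pos (hpos _) _
    have hrw : ∀ z, -(1 / 2) * s * z = -(s / 2) * z := fun z => by ring
    simp only [hrw]
    set T := ∑ i, Real.exp (-(s / 2) * G.dist y (P i n)) with hT
    have hT0 : 0 ≤ T := by positivity
    have h1 : ∑ j, Real.exp (-(s / 2) * G.dist y (x (φ n) j)) ≤
        kbar * (Real.exp (M / 2) * T) := by
      calc _ ≤ ∑ j : Fin kbar, Real.exp (M / 2) * T := Finset.sum_le_sum fun j _ => by
            obtain ⟨i, hi⟩ := hM n j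
            have h2 := MetricGraph.dist_triangle hG y (x (φ n) j) (P i n)
            have h3 : s * G.dist y (P i n) ≤
                s * (G.dist y (x (φ n) j) + G.dist (x (φ n) j) (P i n)) := by gcongr
            calc Real.exp (-(s / 2) * G.dist y (x (φ n) j))
                ≤ Real.exp (M / 2 + -(s / 2) * G.dist y (P i n)) :=
                  Real.exp_le_exp.2 (by linarith)
              _ = Real.exp (M / 2) * Real.exp (-(s / 2) * G.dist y (P i n)) := Real.exp_add _ _
              _ ≤ _ := by
                  gcongr
                  exact Finset.single_le_sum
                    (f := fun i => Real.exp (-(s / 2) * G.dist y (P i n)))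
                    (fun _ _ => (Real.exp_pos _).le) (Finset.mem_univ i)
        _ = _ := by simp
    refine add_le_add ?_ ?_
    · calc C * A * ∑ j, Real.exp (-(s / 2) * G.dist y (x (φ n) j))
          ≤ C * A * (kbar * (Real.exp (M / 2) * T)) := by gcongr
        _ = C * (kbar * Real.exp (M / 2)) * A * T := by ring
        _ ≤ _ := by gcongr; linarith
    · have h2 : C ≤ C * (kbar * Real.exp (M / 2) + 1) := by
        have : 0 ≤ C * (kbar * Real.exp (M / 2)) := by positivity
        linarith
      gcongr
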